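/- Let $\beta>0$, $0<d\le 1$, and for $m\ge 1$ put $a=m\beta/(2d)$. Let $B_\beta$ be the $m\times m$ lower bidiagonal random matrix with jointly independent entries, with diagonal entries $(B_\beta)_{jj}\sim\chi_{2a-\beta(j-1)}$ ($1\le j\le m$) and subdiagonal entries $(B_\beta)_{j+1,j}\sim\chi_{\beta(m-j)}$ ($1\le j\le m-1$), where $\chi_r$ is the law with density $\frac{2^{1-r/2}}{\Gamma(r/2)}x^{r-1}e^{-x^2/2}$ on $(0,\infty)$. Let $M_{\beta,d}=\frac{d}{\beta m}B_\beta B_\beta^t$. Let $M_{\infty,d}$ be $\frac dm$ times the deterministic symmetric tridiagonal $m\times m$ matrix with $(1,1)$ entry $m/d$, $(j,j)$ entry $m/d+m-2(j-1)$ for $2\le j\le m$, and $(j,j+1)$ and $(j+1,j)$ entries $\sqrt{m/d-j+1}\,\sqrt{m-j}$ for $1\le j\le m-1$. For $\Im z>0$ write $$s_\beta(z)=\tfrac1m\operatorname{tr}(M_{\beta,d}-z)^{-1},\qquad s_\infty(z)=\tfrac1m\operatorname{tr}(M_{\infty,d}-z)^{-1},\qquad s_{MP,d}(z)=\int\frac{\rho_{MP,d}(x)}{x-z}\,dx,$$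 where $\rho_{MP,d}(x)=\frac{1}{2\pi d x}\sqrt{(\lambda_+-x)(x-\lambda_-)}\,\mathbf 1_{[\lambda_-,\lambda_+]}(x)$ is the Marchenko–Pastur density and $\lambda_\pm=(1\pm\sqrt d)^2$. Events $E(m)$ hold with overwhelming probability if for each $k$ there is a constant $C_k$ with $\mathbb P(E(m)^c)\le C_k m^{-k}$ for all $m\ge1$. Let $\epsilon,\kappa>0$, and let $D_m$ be the set of all $z\in\mathbb C$ with $\Im z>m^{-1/4+\epsilon}$ and $\lambda_-+\kappa<\Re z<\lambda_+-\kappa$. There is a constant $C>0$, depending only on $\epsilon$ and $\kappa$, such that for all $\beta>0$ and $0<d\le1$: 1. for every $m\ge 1$ and every $z\in D_m$, $\;|s_\infty(z)-s_{MP,d}(z)|\le C m^{-\epsilon}$; 2. with overwhelming probability (with constants $C_k$ that may depend on all the parameters and on the realization of the random variables, but not on $m$ or $z$), simultaneously for all $z\in D_m$, $$|s_\beta(z)-s_\infty(z)|\le C m^{-\epsilon/8}\qquad\text{and}\qquad |s_\beta(z)-s_{MP,d}(z)|\le C m^{-\epsilon/8}.$$ -/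

import Mathlib

open MeasureTheory ProbabilityTheory

noncomputable section

namespace BetaLaguerre

/-- The density of the chi distribution with `r > 0` degrees of freedom. -/
def chiPDFReal (r x : ℝ) : ℝ :=
  if 0 < x then
    (2 : ℝ) ^ (1 - r / 2) / Real.Gamma (r / 2) * x ^ (r - 1) * Real.exp (-(x ^ 2) / 2)
  else 0

/-- The chi distribution with `r > 0` degrees of freedom. -/
def chiMeasure (r : ℝ) : Measure ℝ :=
  volume.withDensity fun x => ENNReal.ofReal (chiPDFReal r x)

/-- The parameter `a = mβ / (2d)` of the ensemble. -/
def param (β d : ℝ) (m : ℕ) : ℝ := m * β / (2 * d)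

/-- The lower bidiagonal matrix with diagonal `x` and subdiagonal `y` (the entry in row `j + 1`
and column `j` is `y j`). -/
def bidiagonal {m : ℕ} (x : Fin m → ℝ) (y : Fin (m - 1) → ℝ) : Matrix (Fin m) (Fin m) ℝ :=
  Matrix.of fun i j =>
    if i = j then x i
    else if h : (i : ℕ) = j + 1 then y ⟨j, by have := i.isLt; omega⟩
    else 0

/-- The normalized matrix `M_{β,d} = (d / (β m)) B Bᵗ`, where `B` is bidiagonal with diagonal `x`
and subdiagonal `y`. -/
def laguerreMatrix (β d : ℝ) {m : ℕ} (x : Fin m → ℝ) (y : Fin (m - 1) → ℝ) :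
    Matrix (Fin m) (Fin m) ℝ :=
  (d / (β * m)) • (bidiagonal x y * (bidiagonal x y).transpose)

/-- The deterministic Jacobi matrix `M_{∞,d}`. With rows and columns numbered from `0`, it is
`d / m` times the symmetric tridiagonal matrix whose diagonal is
`m/d, m/d + m - 2, m/d + m - 4, …, m/d - m + 2` and whose entries in position `(i, i + 1)` are
`√(m/d - i) √(m - 1 - i)`. -/
def limitMatrix (d : ℝ) (m : ℕ) : Matrix (Fin m) (Fin m) ℝ :=
  (d / m) • Matrix.of fun i j : Fin m =>
    if i = j then
      if (i : ℕ) = 0 then (m : ℝ) / d else (m : ℝ) / d + m - 2 * (i : ℕ)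
    else if (j : ℕ) = i + 1 then
      Real.sqrt ((m : ℝ) / d - (i : ℕ)) * Real.sqrt ((m : ℝ) - 1 - (i : ℕ))
    else if (i : ℕ) = j + 1 then
      Real.sqrt ((m : ℝ) / d - (j : ℕ)) * Real.sqrt ((m : ℝ) - 1 - (j : ℕ))
    else 0

/-- The normalized trace of the resolvent, `(1 / m) tr (M - z)⁻¹`. -/
def resolventTrace {m : ℕ} (M : Matrix (Fin m) (Fin m) ℝ) (z : ℂ) : ℂ :=
  1 / (m : ℂ) *
    ((M.map fun t : ℝ => (t : ℂ)) - z • (1 : Matrix (Fin m) (Fin m) ℂ))⁻¹.trace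

/-- The lower spectral edge `λ₋ = (1 - √d)²`. -/
def lambdaMinus (d : ℝ) : ℝ := (1 - Real.sqrt d) ^ 2

/-- The upper spectral edge `λ₊ = (1 + √d)²`. -/
def lambdaPlus (d : ℝ) : ℝ := (1 + Real.sqrt d) ^ 2

/-- The Marchenko–Pastur density with parameter `d`. -/
def mpDensity (d x : ℝ) : ℝ :=
  if lambdaMinus d ≤ x ∧ x ≤ lambdaPlus d then
    1 / (2 * d * Real.pi * x) * Real.sqrt ((lambdaPlus d - x) * (x - lambdaMinus d))
  else 0

/-- The Stieltjes transform of the Marchenko–Pastur distribution with parameter `d`. -/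
def mpStieltjes (d : ℝ) (z : ℂ) : ℂ := ∫ x : ℝ, 1 / ((x : ℂ) - z) * (mpDensity d x : ℂ)

/-- The points `z` with `Im z > m^{-1/4+ε}` and `λ₋ + κ < Re z < λ₊ - κ`. -/
def bulkDomain (d ε κ : ℝ) (m : ℕ) : Set ℂ :=
  {z : ℂ | (m : ℝ) ^ (-(1 / 4 : ℝ) + ε) < z.im ∧
    lambdaMinus d + κ < z.re ∧ z.re < lambdaPlus d - κ}

/-- The events `E m` hold with overwhelming probability: for each `k` there is a constant `C`
such that the complement of `E m` has probability at most `C m^{-k}`. -/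
def WithOverwhelmingProbability {Ω : ℕ → Type*} [∀ m, MeasurableSpace (Ω m)]
    (P : ∀ m, Measure (Ω m)) (E : ∀ m, Set (Ω m)) : Prop :=
  ∀ k : ℕ, ∃ C : ℝ, ∀ m : ℕ, 1 ≤ m →
    P m (E m)ᶜ ≤ ENNReal.ofReal (C * (m : ℝ) ^ (-(k : ℝ)))

/-- For each `m`, the variables `X m 0, …, X m (m - 1), Y m 0, …, Y m (m - 2)` are jointly
independent, `X m i` is `χ_{2a - β i}`-distributed and `Y m j` is
`χ_{β (m - 1 - j)}`-distributed: these are the entries of the bidiagonal matrix `B_β`. -/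
structure IsChiFamily {Ω : ℕ → Type*} [∀ m, MeasurableSpace (Ω m)] (P : ∀ m, Measure (Ω m))
    (β d : ℝ) (X : ∀ m, Fin m → Ω m → ℝ) (Y : ∀ m, Fin (m - 1) → Ω m → ℝ) : Prop where
  indep : ∀ m, iIndepFun (Sum.elim (X m) (Y m)) (P m)
  diag : ∀ m (i : Fin m),
    HasLaw (X m i) (chiMeasure (2 * param β d m - β * (i : ℕ))) (P m)
  subdiag : ∀ m (j : Fin (m - 1)),
    HasLaw (Y m j) (chiMeasure (β * ((m : ℝ) - 1 - (j : ℕ)))) (P m)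

end BetaLaguerre

end

open BetaLaguerre

/-!
The deterministic matrix is `(d / m) B Bᵀ` with `B` bidiagonal with entries `√(m/d - i)` and
`√(m - 1 - j)`. Normalized Laguerre polynomials form a vector `v(x)` such that `(x - B Bᵀ) v(x)` is a
multiple of one basis vector, the factor being a Laguerre polynomial of degree `m`. By Cramer's rule
the characteristic polynomial of `B Bᵀ` is that Laguerre polynomial up to a constant
(`charpoly_limit_gram`), so it solves Laguerre's differential equation, and the logarithmic
derivative of the characteristic polynomial, which is the trace of the resolvent up to sign, solves
a Riccati equation (`riccati_of_ode`). After rescaling this reads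
`d z s² + (z + d - 1) s + 1 = O(1 / (m (Im z)²))` (`limit_quadratic`), the Marchenko–Pastur equation
with a small error.

With `r = √d` and `z = (1 + r q)(r + q) / q`, `0 < |q| < 1`, the roots of the exact equation are
`-q / (r (1 + r q))`, which is the Stieltjes transform (`mpStieltjes_eq`), and `-1 / (r (r + q))`,
which lies in the lower half-plane. Since `Im s ≥ 0`, the approximate solution keeps away from the
second root, and in the bulk the distance is bounded below in terms of `κ` only
(`norm_sub_mpStieltjes_le`). This gives the deterministic estimate, uniformly in `d`.

For the random matrix, a chi variable with `r ≥ β` degrees of freedom has exponential tails around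
`√r` (`chiMeasure_tail`), so with overwhelming probability every entry of the bidiagonal matrix is
within `m^{ε/2}` of its typical value. A Schur test together with the bound `1 / Im z` on the length
of the rows of a resolvent (`norm_resolventTrace_sub_le`) shows that this moves the normalized
resolvent trace by at most `K m^{-ε}`, where `K` depends on `β` and `d`; this is below `m^{-ε/8}` for
large `m`, and the finitely many remaining `m` are absorbed in the constants of the definition of
overwhelming probability. A union bound over the entries suffices.
-/

namespace BetaLaguerre

open Matrix

/-! ### Resolvents of real symmetric matrices -/

section Resolvent

variable {m : ℕ}

/-- The resolvent `(M - z)⁻¹` of a real matrix at a complex point. -/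
noncomputable def resolventMatrix (M : Matrix (Fin m) (Fin m) ℝ) (z : ℂ) :
    Matrix (Fin m) (Fin m) ℂ :=
  ((M.map fun t : ℝ => (t : ℂ)) - z • (1 : Matrix (Fin m) (Fin m) ℂ))⁻¹

theorem ofReal_sub_ne_zero {z : ℂ} (hz : 0 < z.im) (t : ℝ) : (t : ℂ) - z ≠ 0 := by
  intro h
  have := congrArg Complex.im h
  simp at this
  exact hz.ne' this

theorem im_le_norm_ofReal_sub {z : ℂ} (hz : 0 < z.im) (t : ℝ) : z.im ≤ ‖(t : ℂ) - z‖ := by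
  have := Complex.abs_im_le_norm ((t : ℂ) - z)
  simpa [abs_of_pos hz] using this

theorem exists_orthogonal_diagonalization {M : Matrix (Fin m) (Fin m) ℝ} (hM : M.IsHermitian) :
    ∃ U V : Matrix (Fin m) (Fin m) ℂ, V * U = 1 ∧ U * V = 1 ∧
      (M.map fun t : ℝ => (t : ℂ)) = U * diagonal (fun i => (hM.eigenvalues i : ℂ)) * V := by
  let φ : ℝ →+* ℂ := Complex.ofRealHom
  refine ⟨φ.mapMatrix (hM.eigenvectorUnitary : Matrix (Fin m) (Fin m) ℝ),
    φ.mapMatrix (star (hM.eigenvectorUnitary : Matrix (Fin m) (Fin m) ℝ)), ?_, ?_, ?_⟩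
  · rw [← map_mul, Unitary.coe_star_mul_self, map_one]
  · rw [← map_mul, Unitary.mul_star_self_of_mem hM.eigenvectorUnitary.2, map_one]
  · have h := congrArg φ.mapMatrix hM.spectral_theorem
    rw [Unitary.conjStarAlgAut_apply, map_mul, map_mul] at h
    have h2 : φ.mapMatrix (diagonal (RCLike.ofReal ∘ hM.eigenvalues)) =
        diagonal (fun i => (hM.eigenvalues i : ℂ)) := by
      ext i j
      by_cases hij : i = j <;> simp [diagonal, hij, φ]
    rw [h2] at h
    exact h

theorem resolvent_spectral {M : Matrix (Fin m) (Fin m) ℝ} (hM : M.IsHermitian) {z : ℂ}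
    (hz : 0 < z.im) : ∃ U V : Matrix (Fin m) (Fin m) ℂ, V * U = 1 ∧
      ((M.map fun t : ℝ => (t : ℂ)) - z • (1 : Matrix (Fin m) (Fin m) ℂ)) * resolventMatrix M z = 1 ∧
      resolventMatrix M z = U * diagonal (fun i => 1 / ((hM.eigenvalues i : ℂ) - z)) * V := by
  obtain ⟨U, V, hVU, hUV, h⟩ := exists_orthogonal_diagonalization hM
  have hinv : ((M.map fun t : ℝ => (t : ℂ)) - z • (1 : Matrix (Fin m) (Fin m) ℂ)) *
      (U * diagonal (fun i => 1 / ((hM.eigenvalues i : ℂ) - z)) * V) = 1 := by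
    have h1 : (M.map fun t : ℝ => (t : ℂ)) - z • (1 : Matrix (Fin m) (Fin m) ℂ) =
        U * diagonal (fun i => (hM.eigenvalues i : ℂ) - z) * V := by
      have h3 : diagonal (fun i => (hM.eigenvalues i : ℂ) - z) =
          diagonal (fun i => (hM.eigenvalues i : ℂ)) - z • (1 : Matrix (Fin m) (Fin m) ℂ) := by
        ext i j
        by_cases hij : i = j <;> simp [hij]
      rw [h3, Matrix.mul_sub, Matrix.sub_mul, ← h, Matrix.mul_smul, Matrix.smul_mul,
        Matrix.mul_one, hUV]
    have h2 : diagonal (fun i => (hM.eigenvalues i : ℂ) - z) *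
        diagonal (fun i => 1 / ((hM.eigenvalues i : ℂ) - z)) = 1 := by
      rw [diagonal_mul_diagonal, ← diagonal_one]
      congr 1
      ext i
      exact mul_one_div_cancel (ofReal_sub_ne_zero hz _)
    calc _ = U * (diagonal (fun i => (hM.eigenvalues i : ℂ) - z) * (V * U) *
          diagonal (fun i => 1 / ((hM.eigenvalues i : ℂ) - z))) * V := by
            rw [h1]; simp only [Matrix.mul_assoc]
      _ = 1 := by rw [hVU, Matrix.mul_one, h2, Matrix.mul_one, hUV]
  have hres := Matrix.inv_eq_right_inv hinv
  refine ⟨U, V, hVU, ?_, hres⟩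
  rw [resolventMatrix, hres, hinv]

theorem resolventTrace_eq_sum {M : Matrix (Fin m) (Fin m) ℝ} (hM : M.IsHermitian) {z : ℂ}
    (hz : 0 < z.im) :
    resolventTrace M z = 1 / (m : ℂ) * ∑ i, 1 / ((hM.eigenvalues i : ℂ) - z) := by
  obtain ⟨U, V, hVU, -, h⟩ := resolvent_spectral hM hz
  rw [resolventTrace]
  change _ * (resolventMatrix M z).trace = _
  rw [h, Matrix.trace_mul_comm, ← Matrix.mul_assoc, hVU, Matrix.one_mul, trace_diagonal]

/-- Rows of the resolvent have length at most `1 / Im z`. This is the identity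
`G - Gᴴ = (z - z̄) G Gᴴ`, whose diagonal reads `Im z · ∑ₖ |Gᵢₖ|² = Im Gᵢᵢ`. -/
theorem sum_sq_norm_resolvent_le {M : Matrix (Fin m) (Fin m) ℝ} (hM : M.IsHermitian) {z : ℂ}
    (hz : 0 < z.im) (i : Fin m) : ∑ k, ‖resolventMatrix M z i k‖ ^ 2 ≤ 1 / z.im ^ 2 := by
  obtain ⟨-, -, -, hA, -⟩ := resolvent_spectral hM hz
  set G := resolventMatrix M z
  set A := (M.map fun t : ℝ => (t : ℂ)) - z • (1 : Matrix (Fin m) (Fin m) ℂ) with hAdef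
  have hGA : G * A = 1 := mul_eq_one_comm.mp hA
  have hAH : Aᴴ = A + (z - star z) • (1 : Matrix (Fin m) (Fin m) ℂ) := by
    have hMc : (M.map fun t : ℝ => (t : ℂ))ᴴ = M.map fun t : ℝ => (t : ℂ) := by
      ext a b
      have := hM.apply a b
      simp only [star_trivial] at this
      simp [this]
    rw [hAdef, conjTranspose_sub, hMc, conjTranspose_smul, conjTranspose_one, sub_smul]
    abel
  have hGG : G - Gᴴ = (z - star z) • (G * Gᴴ) := by
    have h1 : Aᴴ * Gᴴ = 1 := by rw [← conjTranspose_mul, hGA, conjTranspose_one]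
    have h2 : G * (Aᴴ * Gᴴ) = Gᴴ + (z - star z) • (G * Gᴴ) := by
      rw [hAH, Matrix.add_mul, Matrix.mul_add, ← Matrix.mul_assoc, hGA, Matrix.one_mul,
        Matrix.smul_mul, Matrix.one_mul, Matrix.mul_smul]
    rw [h1, Matrix.mul_one] at h2
    rw [sub_eq_iff_eq_add, add_comm]
    exact h2
  set S := ∑ k, ‖G i k‖ ^ 2 with hS
  have hdiag : (G * Gᴴ) i i = (S : ℂ) := by
    rw [mul_apply, hS]
    push_cast
    refine Finset.sum_congr rfl fun k _ => ?_
    rw [conjTranspose_apply]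
    exact Complex.mul_conj' _
  have him : (G i i).im = z.im * S := by
    have h := congrArg Complex.im (congrFun (congrFun hGG i) i)
    rw [Matrix.smul_apply, hdiag] at h
    simp at h
    linarith
  have hle : ‖G i i‖ ^ 2 ≤ S :=
    Finset.single_le_sum (f := fun k => ‖G i k‖ ^ 2) (fun k _ => by positivity) (Finset.mem_univ i)
  have hS0 : 0 ≤ S := Finset.sum_nonneg fun k _ => by positivity
  clear_value S
  have h1 : z.im * S ≤ ‖G i i‖ := him ▸ (le_abs_self _).trans (Complex.abs_im_le_norm _)
  have h2 : (z.im * S) ^ 2 ≤ S := (pow_le_pow_left₀ (mul_nonneg hz.le hS0) h1 2).trans hle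
  rw [le_div_iff₀ (by positivity)]
  by_contra hcon
  push Not at hcon
  nlinarith [mul_pos hz hz]

theorem sum_sq_norm_resolvent_col_le {M : Matrix (Fin m) (Fin m) ℝ} (hM : M.IsHermitian) {z : ℂ}
    (hz : 0 < z.im) (i : Fin m) : ∑ k, ‖resolventMatrix M z k i‖ ^ 2 ≤ 1 / z.im ^ 2 := by
  have hsymm : (resolventMatrix M z)ᵀ = resolventMatrix M z := by
    rw [resolventMatrix, transpose_nonsing_inv, transpose_sub, transpose_smul, transpose_one,
      ← transpose_map]
    have : Mᵀ = M := by simpa [Matrix.IsHermitian, conjTranspose_eq_transpose_of_trivial] using hM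
    rw [this]
  refine le_trans (le_of_eq ?_) (sum_sq_norm_resolvent_le hM hz i)
  refine Finset.sum_congr rfl fun k _ => ?_
  conv_rhs => rw [← hsymm]
  rfl

/-- Stability of the normalized resolvent trace, by the Schur test: the perturbation enters only
through its absolute row and column sums. -/
theorem norm_resolventTrace_sub_le {M N : Matrix (Fin m) (Fin m) ℝ} (hm : 1 ≤ m)
    (hM : M.IsHermitian) (hN : N.IsHermitian) {z : ℂ} (hz : 0 < z.im) {K : ℝ}
    (hrow : ∀ i, ∑ j, |(N - M) i j| ≤ K) (hcol : ∀ j, ∑ i, |(N - M) i j| ≤ K) :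
    ‖resolventTrace M z - resolventTrace N z‖ ≤ K / z.im ^ 2 := by
  obtain ⟨-, -, -, hA, -⟩ := resolvent_spectral hM hz
  obtain ⟨-, -, -, hB, -⟩ := resolvent_spectral hN hz
  have hm' : (0 : ℝ) < m := by exact_mod_cast hm
  set G := resolventMatrix M z with hG
  set H := resolventMatrix N z with hH
  set D : Matrix (Fin m) (Fin m) ℂ := (N - M).map fun t : ℝ => (t : ℂ) with hD
  have hGH : G - H = G * D * H := by
    have h1 : G * (((M.map fun t : ℝ => (t : ℂ)) - z • (1 : Matrix (Fin m) (Fin m) ℂ))) = 1 :=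
      mul_eq_one_comm.mp hA
    have h2 : D = ((N.map fun t : ℝ => (t : ℂ)) - z • (1 : Matrix (Fin m) (Fin m) ℂ)) -
        ((M.map fun t : ℝ => (t : ℂ)) - z • (1 : Matrix (Fin m) (Fin m) ℂ)) := by
      ext i j
      simp [hD]
    rw [h2, Matrix.mul_sub, Matrix.sub_mul, Matrix.mul_assoc, hB, h1, Matrix.mul_one,
      Matrix.one_mul]
  have htr : ‖(G - H).trace‖ ≤ m * (K / z.im ^ 2) := by
    have hbound : ‖(G - H).trace‖ ≤
        ∑ k, ∑ j, ∑ i, |(N - M) i j| * ((‖G k i‖ ^ 2 + ‖H j k‖ ^ 2) / 2) := by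
      rw [hGH, Matrix.trace]
      refine (norm_sum_le _ _).trans (Finset.sum_le_sum fun k _ => ?_)
      rw [diag_apply, mul_apply]
      refine (norm_sum_le _ _).trans (Finset.sum_le_sum fun j _ => ?_)
      rw [mul_apply, Finset.sum_mul]
      refine (norm_sum_le _ _).trans (Finset.sum_le_sum fun i _ => ?_)
      have hn : ‖D i j‖ = |(N - M) i j| := by
        rw [hD, map_apply, Complex.norm_real, Real.norm_eq_abs]
      rw [norm_mul, norm_mul, hn]
      have h0 : ‖G k i‖ * ‖H j k‖ ≤ (‖G k i‖ ^ 2 + ‖H j k‖ ^ 2) / 2 := by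
        nlinarith [sq_nonneg (‖G k i‖ - ‖H j k‖)]
      calc ‖G k i‖ * |(N - M) i j| * ‖H j k‖ = |(N - M) i j| * (‖G k i‖ * ‖H j k‖) := by ring
        _ ≤ _ := mul_le_mul_of_nonneg_left h0 (abs_nonneg _)
    have hsplit : ∀ a g h : Fin m → Fin m → ℝ, ∑ k, ∑ j, ∑ i, a i j * ((g k i + h j k) / 2) =
        (∑ k, ∑ i, (∑ j, a i j) * g k i) / 2 + (∑ k, ∑ j, (∑ i, a i j) * h j k) / 2 := by
      intro a g h
      rw [← add_div, ← Finset.sum_add_distrib, Finset.sum_div]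
      refine Finset.sum_congr rfl fun k _ => ?_
      simp only [Finset.sum_mul]
      rw [Finset.sum_comm (f := fun i j => a i j * g k i), ← Finset.sum_add_distrib,
        Finset.sum_div]
      refine Finset.sum_congr rfl fun j _ => ?_
      rw [← Finset.sum_add_distrib, Finset.sum_div]
      refine Finset.sum_congr rfl fun i _ => ?_
      ring
    have hK0 : 0 ≤ K := (Finset.sum_nonneg fun j _ => abs_nonneg _).trans (hrow ⟨0, hm⟩)
    have hb1 : ∑ k, ∑ i, (∑ j, |(N - M) i j|) * ‖G k i‖ ^ 2 ≤ m * (K / z.im ^ 2) := by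
      have : ∀ k, ∑ i, (∑ j, |(N - M) i j|) * ‖G k i‖ ^ 2 ≤ K / z.im ^ 2 := fun k => by
        calc _ ≤ ∑ i, K * ‖G k i‖ ^ 2 := Finset.sum_le_sum fun i _ =>
              mul_le_mul_of_nonneg_right (hrow i) (by positivity)
          _ = K * ∑ i, ‖G k i‖ ^ 2 := by rw [Finset.mul_sum]
          _ ≤ K * (1 / z.im ^ 2) :=
              mul_le_mul_of_nonneg_left (sum_sq_norm_resolvent_le hM hz k) hK0
          _ = _ := by ring
      refine (Finset.sum_le_sum fun k _ => this k).trans (by simp)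
    have hb2 : ∑ k, ∑ j, (∑ i, |(N - M) i j|) * ‖H j k‖ ^ 2 ≤ m * (K / z.im ^ 2) := by
      have : ∀ k, ∑ j, (∑ i, |(N - M) i j|) * ‖H j k‖ ^ 2 ≤ K / z.im ^ 2 := fun k => by
        calc _ ≤ ∑ j, K * ‖H j k‖ ^ 2 := Finset.sum_le_sum fun j _ =>
              mul_le_mul_of_nonneg_right (hcol j) (by positivity)
          _ = K * ∑ j, ‖H j k‖ ^ 2 := by rw [Finset.mul_sum]
          _ ≤ K * (1 / z.im ^ 2) :=
              mul_le_mul_of_nonneg_left (sum_sq_norm_resolvent_col_le hN hz k) hK0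
          _ = _ := by ring
      refine (Finset.sum_le_sum fun k _ => this k).trans (by simp)
    rw [hsplit (fun i j => |(N - M) i j|) (fun k i => ‖G k i‖ ^ 2)
      (fun j k => ‖H j k‖ ^ 2)] at hbound
    linarith
  have heq : resolventTrace M z - resolventTrace N z = 1 / (m : ℂ) * (G - H).trace := by
    rw [resolventTrace, resolventTrace, trace_sub, mul_sub]
    rfl
  rw [heq, norm_mul, norm_div, norm_one, Complex.norm_natCast, one_div_mul_eq_div,
    div_le_iff₀ hm']
  linarith

end Resolvent

/-! ### Bidiagonal matrices -/

section Bidiagonal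

variable {m : ℕ}

theorem sum_bidiagonal_row {N : Type*} [AddCommGroup N] [Module ℝ N] (x : Fin m → ℝ)
    (y : Fin (m - 1) → ℝ) (f : Fin m → N) (i : Fin m) :
    ∑ k, bidiagonal x y i k • f k = x i • f i +
      if h : 0 < (i : ℕ) then
        y ⟨i - 1, by have := i.isLt; omega⟩ • f ⟨i - 1, by have := i.isLt; omega⟩ else 0 := by
  have hx : ∑ k, (if i = k then x i • f i else 0) = x i • f i := by simp
  rw [← hx]
  have hy : (if h : 0 < (i : ℕ) then
        y ⟨i - 1, by have := i.isLt; omega⟩ • f ⟨i - 1, by have := i.isLt; omega⟩ else 0) =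
      ∑ k : Fin m, if h : (i : ℕ) = k + 1 then
        y ⟨k, by have := i.isLt; omega⟩ • f k else 0 := by
    split_ifs with h
    · rw [Finset.sum_eq_single (⟨i - 1, by have := i.isLt; omega⟩ : Fin m)]
      · rw [dif_pos (by simp only []; omega)]
      · intro b _ hb
        rw [dif_neg]
        intro h2
        exact hb (Fin.ext (by simp only []; omega))
      · simp
    · rw [Finset.sum_eq_zero]
      intro k _
      rw [dif_neg (by omega)]
  rw [hy, ← Finset.sum_add_distrib]
  refine Finset.sum_congr rfl fun k _ => ?_
  rw [bidiagonal, of_apply]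
  by_cases h1 : i = k
  · subst h1
    simp
  · rw [if_neg h1, if_neg h1, zero_add]
    split_ifs
    · rfl
    · exact zero_smul _ _

theorem sum_bidiagonal_col {N : Type*} [AddCommGroup N] [Module ℝ N] (x : Fin m → ℝ)
    (y : Fin (m - 1) → ℝ) (f : Fin m → N) (k : Fin m) :
    ∑ i, bidiagonal x y i k • f i = x k • f k +
      if h : (k : ℕ) + 1 < m then y ⟨k, by omega⟩ • f ⟨k + 1, h⟩ else 0 := by
  have hx : ∑ i, (if i = k then x i • f i else 0) = x k • f k := by simp
  rw [← hx]
  have hy : (if h : (k : ℕ) + 1 < m then y ⟨k, by omega⟩ • f ⟨k + 1, h⟩ else 0) =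
      ∑ i : Fin m, if h : (i : ℕ) = k + 1 then
        y ⟨k, by have := i.isLt; omega⟩ • f i else 0 := by
    split_ifs with h
    · rw [Finset.sum_eq_single (⟨k + 1, h⟩ : Fin m)]
      · rw [dif_pos rfl]
      · intro b _ hb
        rw [dif_neg]
        intro h2
        exact hb (Fin.ext h2)
      · simp
    · rw [Finset.sum_eq_zero]
      intro i _
      rw [dif_neg (by have := i.isLt; omega)]
  rw [hy, ← Finset.sum_add_distrib]
  refine Finset.sum_congr rfl fun i _ => ?_
  rw [bidiagonal, of_apply]
  by_cases h1 : i = k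
  · subst h1
    simp
  · rw [if_neg h1, if_neg h1, zero_add]
    split_ifs
    · rfl
    · exact zero_smul _ _

theorem abs_bidiagonal (x : Fin m → ℝ) (y : Fin (m - 1) → ℝ) (i j : Fin m) :
    |bidiagonal x y i j| = bidiagonal (fun i => |x i|) (fun j => |y j|) i j := by
  simp only [bidiagonal, of_apply]
  split_ifs <;> simp

theorem sum_abs_bidiagonal_row_le {x : Fin m → ℝ} {y : Fin (m - 1) → ℝ} {K : ℝ}
    (hx : ∀ i, |x i| ≤ K) (hy : ∀ i, |y i| ≤ K) (i : Fin m) :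
    ∑ j, |bidiagonal x y i j| ≤ 2 * K := by
  have h := sum_bidiagonal_row (fun i => |x i|) (fun j => |y j|) (fun _ => (1 : ℝ)) i
  simp only [smul_eq_mul, mul_one] at h
  simp only [abs_bidiagonal, h]
  have hK : 0 ≤ K := (abs_nonneg _).trans (hx i)
  split_ifs with h0
  · linarith [hx i, hy ⟨i - 1, by have := i.isLt; omega⟩]
  · linarith [hx i]

theorem sum_abs_bidiagonal_col_le {x : Fin m → ℝ} {y : Fin (m - 1) → ℝ} {K : ℝ}
    (hx : ∀ i, |x i| ≤ K) (hy : ∀ i, |y i| ≤ K) (j : Fin m) :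
    ∑ i, |bidiagonal x y i j| ≤ 2 * K := by
  have h := sum_bidiagonal_col (fun i => |x i|) (fun j => |y j|) (fun _ => (1 : ℝ)) j
  simp only [smul_eq_mul, mul_one] at h
  simp only [abs_bidiagonal, h]
  have hK : 0 ≤ K := (abs_nonneg _).trans (hx j)
  split_ifs with h0
  · linarith [hx j, hy ⟨j, by omega⟩]
  · linarith [hx j]

theorem bidiagonal_sub (x x' : Fin m → ℝ) (y y' : Fin (m - 1) → ℝ) :
    bidiagonal x y - bidiagonal x' y' =
      bidiagonal (fun i => x i - x' i) (fun i => y i - y' i) := by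
  ext i j
  simp only [bidiagonal, Matrix.sub_apply, of_apply]
  by_cases h1 : i = j
  · simp only [if_pos h1]
  · by_cases h2 : (i : ℕ) = j + 1
    · simp only [if_neg h1, dif_pos h2]
    · simp only [if_neg h1, dif_neg h2, sub_zero]

theorem bidiagonal_smul (c : ℝ) (x : Fin m → ℝ) (y : Fin (m - 1) → ℝ) :
    c • bidiagonal x y = bidiagonal (fun i => c * x i) (fun i => c * y i) := by
  ext i j
  simp only [bidiagonal, Matrix.smul_apply, of_apply, smul_eq_mul]
  by_cases h1 : i = j
  · simp only [if_pos h1]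
  · by_cases h2 : (i : ℕ) = j + 1
    · simp only [if_neg h1, dif_pos h2]
    · simp only [if_neg h1, dif_neg h2, mul_zero]

theorem sum_abs_mul_transpose_le {A B : Matrix (Fin m) (Fin m) ℝ} {a b : ℝ}
    (hA : ∀ i, ∑ j, |A i j| ≤ a) (hB : ∀ j, ∑ i, |B i j| ≤ b) (hb : 0 ≤ b) (i : Fin m) :
    ∑ j, |(A * Bᵀ) i j| ≤ a * b := by
  calc ∑ j, |(A * Bᵀ) i j| ≤ ∑ j, ∑ k, |A i k| * |B j k| := by
        refine Finset.sum_le_sum fun j _ => ?_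
        rw [mul_apply]
        refine (Finset.abs_sum_le_sum_abs _ _).trans (le_of_eq ?_)
        simp [abs_mul]
    _ = ∑ k, |A i k| * ∑ j, |B j k| := by
        rw [Finset.sum_comm]
        simp only [Finset.mul_sum]
    _ ≤ ∑ k, |A i k| * b := Finset.sum_le_sum fun k _ =>
        mul_le_mul_of_nonneg_left (hB k) (abs_nonneg _)
    _ = (∑ k, |A i k|) * b := by rw [Finset.sum_mul]
    _ ≤ a * b := mul_le_mul_of_nonneg_right (hA i) hb

/-- Perturbing the entries of a bidiagonal matrix of size `R` by at most `u` changes the absolute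
row sums of its Gram matrix by at most `4u(2R + u)`. -/
theorem sum_abs_gram_sub_le {x x' : Fin m → ℝ} {y y' : Fin (m - 1) → ℝ} {R u : ℝ}
    (hR : 0 ≤ R) (hu : 0 ≤ u) (hx' : ∀ i, |x' i| ≤ R) (hy' : ∀ i, |y' i| ≤ R)
    (hx : ∀ i, |x i - x' i| ≤ u) (hy : ∀ i, |y i - y' i| ≤ u) (i : Fin m) :
    ∑ j, |(bidiagonal x y * (bidiagonal x y)ᵀ - bidiagonal x' y' * (bidiagonal x' y')ᵀ) i j| ≤
      4 * u * (2 * R + u) := by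
  have hxR : ∀ i, |x i| ≤ R + u := fun i => by
    have := abs_add_le (x' i) (x i - x' i)
    rw [add_sub_cancel] at this
    linarith [hx i, hx' i]
  have hyR : ∀ i, |y i| ≤ R + u := fun i => by
    have := abs_add_le (y' i) (y i - y' i)
    rw [add_sub_cancel] at this
    linarith [hy i, hy' i]
  set E := bidiagonal (fun i => x i - x' i) (fun i => y i - y' i) with hE
  have hdecomp : bidiagonal x y * (bidiagonal x y)ᵀ - bidiagonal x' y' * (bidiagonal x' y')ᵀ =
      E * (bidiagonal x y)ᵀ + bidiagonal x' y' * Eᵀ := by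
    rw [hE, ← bidiagonal_sub, transpose_sub, Matrix.sub_mul, Matrix.mul_sub]
    abel
  rw [hdecomp]
  have h1 := sum_abs_mul_transpose_le (sum_abs_bidiagonal_row_le hx hy)
    (sum_abs_bidiagonal_col_le hxR hyR) (by positivity) i
  have h2 := sum_abs_mul_transpose_le (sum_abs_bidiagonal_row_le hx' hy')
    (sum_abs_bidiagonal_col_le hx hy) (by positivity) i
  calc _ ≤ ∑ j, (|(E * (bidiagonal x y)ᵀ) i j| + |(bidiagonal x' y' * Eᵀ) i j|) :=
        Finset.sum_le_sum fun j _ => by rw [Matrix.add_apply]; exact abs_add_le _ _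
    _ ≤ 2 * u * (2 * (R + u)) + 2 * R * (2 * u) := by
        rw [Finset.sum_add_distrib]; exact add_le_add h1 h2
    _ = _ := by ring

theorem isHermitian_gram (A : Matrix (Fin m) (Fin m) ℝ) : (A * Aᵀ).IsHermitian := by
  simpa using! isHermitian_mul_conjTranspose_self A

theorem isHermitian_smul_gram (c : ℝ) (A : Matrix (Fin m) (Fin m) ℝ) :
    (c • (A * Aᵀ)).IsHermitian := by
  have h := isHermitian_gram A
  rw [Matrix.IsHermitian] at h ⊢
  rw [conjTranspose_smul, h, star_trivial]

end Bidiagonal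

end BetaLaguerre

namespace BetaLaguerre

open Matrix

/-! ### Laguerre polynomials and the characteristic polynomial of the deterministic matrix -/

section Laguerre

open Polynomial

/-- The pair `(L_n, L_n - L_{n-1})`, where `L_n` is the Laguerre polynomial of degree `n` with
parameter `α` and `L_{-1} = 0`. The second component is the Laguerre polynomial with parameter
`α - 1`. -/
noncomputable def laguerrePair (α : ℝ) : ℕ → ℝ[X] × ℝ[X]
  | 0 => (1, 1)
  | n + 1 =>
    ((laguerrePair α n).1 + C ((n + 1 : ℝ)⁻¹) *
        (C (n + α) * (laguerrePair α n).2 - X * (laguerrePair α n).1),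
      C ((n + 1 : ℝ)⁻¹) * (C (n + α) * (laguerrePair α n).2 - X * (laguerrePair α n).1))

/-- The Laguerre polynomial `L_n` with parameter `α`. -/
noncomputable def laguerre (α : ℝ) (n : ℕ) : ℝ[X] := (laguerrePair α n).1

/-- The difference `L_n - L_{n-1}` of consecutive Laguerre polynomials with parameter `α`. -/
noncomputable def laguerreDiff (α : ℝ) (n : ℕ) : ℝ[X] := (laguerrePair α n).2

theorem laguerre_zero (α : ℝ) : laguerre α 0 = 1 := rfl

theorem laguerreDiff_zero (α : ℝ) : laguerreDiff α 0 = 1 := rfl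

theorem laguerre_succ (α : ℝ) (n : ℕ) :
    laguerre α (n + 1) = laguerre α n + laguerreDiff α (n + 1) := rfl

theorem laguerreDiff_succ (α : ℝ) (n : ℕ) :
    C (n + 1 : ℝ) * laguerreDiff α (n + 1) =
      C (n + α) * laguerreDiff α n - X * laguerre α n := by
  have h : laguerreDiff α (n + 1) =
      C ((n + 1 : ℝ)⁻¹) * (C (n + α) * laguerreDiff α n - X * laguerre α n) := rfl
  rw [h, ← mul_assoc, ← C_mul, mul_inv_cancel₀ (by positivity), C_1, one_mul]

/-- The first-order differential system satisfied by consecutive Laguerre polynomials. -/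
theorem derivative_laguerre (α : ℝ) (n : ℕ) :
    derivative (laguerreDiff α n) = laguerreDiff α n - laguerre α n ∧
      X * derivative (laguerre α n) = C (n + α) * laguerreDiff α n - C α * laguerre α n := by
  induction n with
  | zero => simp [laguerre_zero, laguerreDiff_zero]
  | succ n ih =>
    obtain ⟨h1, h2⟩ := ih
    have hrec := laguerreDiff_succ α n
    have hd := congrArg derivative hrec
    simp only [derivative_mul, derivative_C, zero_mul, zero_add, derivative_sub, derivative_X,
      one_mul] at hd
    have hD : derivative (laguerreDiff α (n + 1)) =
        laguerreDiff α (n + 1) - laguerre α (n + 1) := by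
      have hne : C (n + 1 : ℝ) ≠ 0 := by
        rw [Ne, C_eq_zero]
        positivity
      apply mul_left_cancel₀ hne
      rw [hd, laguerre_succ, h1]
      simp only [C_add, C_1] at *
      linear_combination -h2
    refine ⟨hD, ?_⟩
    rw [laguerre_succ] at hD ⊢
    rw [derivative_add, mul_add, hD, h2]
    push_cast
    simp only [C_add, C_1] at *
    linear_combination -hrec

/-- Laguerre's differential equation. -/
theorem laguerreDiff_ode (α : ℝ) (n : ℕ) :
    X * derivative (derivative (laguerreDiff α n)) +
      (C α - X) * derivative (laguerreDiff α n) + C (n : ℝ) * laguerreDiff α n = 0 := by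
  obtain ⟨h1, h2⟩ := derivative_laguerre α n
  have h3 := congrArg derivative h1
  rw [derivative_sub] at h3
  rw [h3]
  simp only [C_add] at *
  linear_combination (C α) * h1 - h2

theorem natDegree_laguerre (α : ℝ) (n : ℕ) :
    (laguerre α n).natDegree ≤ n ∧ (laguerreDiff α n).natDegree ≤ n ∧
      (laguerre α n).coeff n = (laguerreDiff α n).coeff n ∧ (laguerreDiff α n).coeff n ≠ 0 := by
  induction n with
  | zero => simp [laguerre_zero, laguerreDiff_zero]
  | succ n ih =>
    obtain ⟨h1, h2, h3, h4⟩ := ih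
    have h : laguerreDiff α (n + 1) =
      C ((n + 1 : ℝ)⁻¹) * (C (n + α) * laguerreDiff α n - X * laguerre α n) := rfl
    have hD : (laguerreDiff α (n + 1)).natDegree ≤ n + 1 := by
      rw [h]
      refine (natDegree_C_mul_le _ _).trans ((natDegree_sub_le _ _).trans (max_le ?_ ?_))
      · exact (natDegree_C_mul_le _ _).trans (by omega)
      · refine natDegree_mul_le.trans ?_
        rw [natDegree_X]
        omega
    have hz1 : (laguerre α n).coeff (n + 1) = 0 := coeff_eq_zero_of_natDegree_lt (by omega)
    have hz2 : (laguerreDiff α n).coeff (n + 1) = 0 := coeff_eq_zero_of_natDegree_lt (by omega)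
    refine ⟨?_, hD, ?_, ?_⟩
    · rw [laguerre_succ]
      exact (natDegree_add_le _ _).trans (max_le (by omega) hD)
    · rw [laguerre_succ, coeff_add, hz1, zero_add]
    · rw [h, coeff_C_mul, coeff_sub, coeff_C_mul, hz2, coeff_X_mul, mul_zero, zero_sub, h3]
      have : (n + 1 : ℝ) ≠ 0 := by positivity
      exact mul_ne_zero (inv_ne_zero this) (neg_ne_zero.mpr h4)

/-- The bidiagonal factor of the deterministic matrix: its diagonal is `√(A - i)` and its
subdiagonal is `√(m - 1 - j)`. -/
noncomputable def limitBidiagonal (A : ℝ) (m : ℕ) : Matrix (Fin m) (Fin m) ℝ :=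
  bidiagonal (fun i => Real.sqrt (A - (i : ℕ))) (fun j => Real.sqrt ((m : ℝ) - 1 - (j : ℕ)))

/-- The normalizing constants that turn Laguerre polynomials into the entries of an eigenvector of
the symmetric Jacobi matrix. -/
noncomputable def laguerreNorm (α : ℝ) : ℕ → ℝ
  | 0 => 1
  | n + 1 => -(Real.sqrt (n + 1) / Real.sqrt (n + 1 + α)) * laguerreNorm α n

theorem laguerreNorm_succ {α : ℝ} (hα : 0 ≤ α) (n : ℕ) :
    Real.sqrt (n + 1 + α) * laguerreNorm α (n + 1) = -(Real.sqrt (n + 1) * laguerreNorm α n) := by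
  have : Real.sqrt (n + 1 + α) ≠ 0 := by positivity
  rw [laguerreNorm]
  field_simp

theorem limitBidiagonal_transpose_mulVec {A : ℝ} {m : ℕ} (hA : (m : ℝ) ≤ A) (j : Fin m) :
    ∑ k, limitBidiagonal A m k j •
        (C (laguerreNorm (A - m + 1) (m - 1 - (k : ℕ))) *
          laguerre (A - m + 1) (m - 1 - (k : ℕ))) =
      C (Real.sqrt (A - (j : ℕ)) * laguerreNorm (A - m + 1) (m - 1 - (j : ℕ))) *
        laguerreDiff (A - m + 1) (m - 1 - (j : ℕ)) := by
  obtain ⟨j, hj⟩ := j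
  rw [limitBidiagonal, sum_bidiagonal_col]
  set α := A - m + 1 with hα
  have hα0 : 0 ≤ α := by linarith
  simp only [smul_eq_C_mul, ← mul_assoc, ← C_mul]
  rcases Nat.lt_or_ge (j + 1) m with h | h
  · obtain ⟨n, hn⟩ : ∃ n, m - 1 - j = n + 1 := ⟨m - 1 - j - 1, by omega⟩
    have hn' : m - 1 - (j + 1) = n := by omega
    have hmj : (m : ℝ) - 1 - j = n + 1 := by
      have : m = n + 1 + 1 + j := by omega
      rw [this]; push_cast; ring
    have hAj : A - j = n + 1 + α := by rw [hα]; linarith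
    rw [dif_pos h, hn, hn', hmj, hAj, laguerreNorm_succ hα0, laguerre_succ]
    simp only [C_neg]
    ring
  · have h0 : m - 1 - j = 0 := by omega
    rw [dif_neg (by omega), h0, laguerre_zero, laguerreDiff_zero, add_zero]

theorem limitBidiagonal_mulVec {A : ℝ} {m : ℕ} (hA : (m : ℝ) ≤ A) (i : Fin m) :
    ∑ k, limitBidiagonal A m i k •
        (C (Real.sqrt (A - (k : ℕ)) * laguerreNorm (A - m + 1) (m - 1 - (k : ℕ))) *
          laguerreDiff (A - m + 1) (m - 1 - (k : ℕ))) =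
      X * (C (laguerreNorm (A - m + 1) (m - 1 - (i : ℕ))) *
          laguerre (A - m + 1) (m - 1 - (i : ℕ))) +
      if (i : ℕ) = 0 then
        C (m * laguerreNorm (A - m + 1) (m - 1)) * laguerreDiff (A - m + 1) m else 0 := by
  obtain ⟨i, hi⟩ := i
  rw [limitBidiagonal, sum_bidiagonal_row]
  set α := A - m + 1 with hα
  have hα0 : 0 ≤ α := by linarith
  simp only [smul_eq_C_mul, ← mul_assoc, ← C_mul]
  obtain ⟨n, hn⟩ : ∃ n, m - 1 - i = n := ⟨_, rfl⟩
  have hm : m = n + 1 + i := by omega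
  have hAi : A - i = n + α := by rw [hα, hm]; push_cast; ring
  have hsq : Real.sqrt (n + α) * Real.sqrt (n + α) = n + α := Real.mul_self_sqrt (by positivity)
  have hrec := laguerreDiff_succ α n
  rw [hn, hAi, hsq]
  rcases Nat.eq_zero_or_pos i with h | h
  · subst h
    have hm1 : m - 1 = n := by omega
    -- The first row lacks a subdiagonal entry, which leaves the multiple of `D_m` as a remainder.
    rw [dif_neg (by omega), if_pos rfl, hm1, add_zero]
    have hm2 : m = n + 1 := by omega
    rw [hm2]
    push_cast
    simp only [C_mul] at *
    linear_combination -(C (laguerreNorm α n)) * hrec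
  · have hn1 : m - 1 - (i - 1) = n + 1 := by omega
    have hi1 : ((i - 1 : ℕ) : ℝ) = i - 1 := by rw [Nat.cast_sub h]; simp
    have hA1 : A - ((i - 1 : ℕ) : ℝ) = n + 1 + α := by rw [hi1]; linarith
    have hm1 : (m : ℝ) - 1 - ((i - 1 : ℕ) : ℝ) = n + 1 := by rw [hi1, hm]; push_cast; ring
    have hsq1 : Real.sqrt (n + 1) * Real.sqrt (n + 1) = n + 1 :=
      Real.mul_self_sqrt (by positivity)
    rw [dif_pos h, if_neg h.ne', hn1, hA1, hm1, mul_assoc (Real.sqrt _),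
      laguerreNorm_succ hα0, mul_neg, ← mul_assoc, hsq1, add_zero]
    simp only [C_mul, C_neg] at *
    linear_combination -(C (laguerreNorm α n)) * hrec

/-- The characteristic polynomial of `B Bᵀ` is a multiple of a Laguerre polynomial: the vector
`v(x)` of normalized Laguerre polynomials satisfies `(x - B Bᵀ) v(x) = c · D_m(x) e₀`, so
Cramer's rule makes `D_m` a divisor of the characteristic polynomial, and the degrees agree. -/
theorem charpoly_limit_gram {A : ℝ} {m : ℕ} (hm : 1 ≤ m) (hA : (m : ℝ) ≤ A) :
    ∃ a : ℝ, (limitBidiagonal A m * (limitBidiagonal A m)ᵀ).charpoly =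
      C a * laguerreDiff (A - m + 1) m := by
  set B := limitBidiagonal A m with hB
  set α := A - m + 1 with hα
  set v : Fin m → ℝ[X] := fun k =>
    C (laguerreNorm α (m - 1 - (k : ℕ))) * laguerre α (m - 1 - (k : ℕ)) with hv
  have hBBv : ∀ i, ∑ j, (B * Bᵀ) i j • v j = X * v i + if (i : ℕ) = 0 then
        C (m * laguerreNorm α (m - 1)) * laguerreDiff α m else 0 := by
    intro i
    rw [← limitBidiagonal_mulVec hA i]
    simp only [mul_apply, transpose_apply, Finset.sum_smul]
    rw [Finset.sum_comm]
    refine Finset.sum_congr rfl fun k _ => ?_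
    rw [← limitBidiagonal_transpose_mulVec hA k, Finset.smul_sum]
    refine Finset.sum_congr rfl fun j _ => ?_
    rw [mul_smul]
  have hchar : ∀ i, ((B * Bᵀ).charmatrix *ᵥ v) i = if (i : ℕ) = 0 then
        -(C (m * laguerreNorm α (m - 1)) * laguerreDiff α m) else 0 := by
    intro i
    have h1 : ((B * Bᵀ).charmatrix *ᵥ v) i = X * v i - ∑ j, (B * Bᵀ) i j • v j := by
      rw [mulVec, dotProduct]
      have : ∀ j, (B * Bᵀ).charmatrix i j * v j =
          (if i = j then X * v i else 0) - (B * Bᵀ) i j • v j := by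
        intro j
        rw [charmatrix_apply, sub_mul, smul_eq_C_mul]
        by_cases hij : i = j
        · subst hij; simp
        · simp [hij]
      simp only [this, Finset.sum_sub_distrib]
      simp
    rw [h1, hBBv]
    split_ifs <;> ring
  set l : Fin m := ⟨m - 1, by omega⟩ with hl
  have hvl : v l = 1 := by
    have : m - 1 - ((l : Fin m) : ℕ) = 0 := by rw [hl]; simp
    simp only [hv, this]
    simp [laguerreNorm, laguerre_zero]
  have hcramer : (B * Bᵀ).charpoly = (B * Bᵀ).charmatrix.adjugate l ⟨0, hm⟩ *
      -(C (m * laguerreNorm α (m - 1)) * laguerreDiff α m) := by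
    have h1 : (B * Bᵀ).charmatrix.adjugate *ᵥ ((B * Bᵀ).charmatrix *ᵥ v) =
        (B * Bᵀ).charpoly • v := by
      rw [mulVec_mulVec, adjugate_mul, smul_mulVec, one_mulVec, charpoly]
    have h2 := congrFun h1 l
    rw [Pi.smul_apply, hvl, smul_eq_mul, mul_one] at h2
    rw [← h2, mulVec, dotProduct, Finset.sum_eq_single (⟨0, hm⟩ : Fin m)]
    · rw [hchar, if_pos rfl]
    · intro b _ hb
      rw [hchar, if_neg (fun h => hb (Fin.ext h)), mul_zero]
    · simp
  obtain ⟨q, hq⟩ : laguerreDiff α m ∣ (B * Bᵀ).charpoly := by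
    rw [hcramer]
    exact Dvd.intro_left
      (-((B * Bᵀ).charmatrix.adjugate l ⟨0, hm⟩ * C (m * laguerreNorm α (m - 1)))) (by ring)
  have hmonic := charpoly_monic (B * Bᵀ)
  have hq0 : q ≠ 0 := by
    rintro rfl
    rw [mul_zero] at hq
    exact hmonic.ne_zero hq
  obtain ⟨-, hdeg, -, hne⟩ := natDegree_laguerre α m
  have hD0 : laguerreDiff α m ≠ 0 := by
    intro h
    rw [h, coeff_zero] at hne
    exact hne rfl
  have hdeg' : m ≤ (laguerreDiff α m).natDegree := le_natDegree_of_ne_zero hne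
  have hnd : (B * Bᵀ).charpoly.natDegree = m := by rw [charpoly_natDegree_eq_dim, Fintype.card_fin]
  rw [hq, natDegree_mul hD0 hq0] at hnd
  obtain ⟨a, ha⟩ := natDegree_eq_zero.mp (show q.natDegree = 0 by omega)
  exact ⟨a, by rw [hq, ← ha, mul_comm]⟩

theorem charpoly_limit_gram_ode {A : ℝ} {m : ℕ} (hm : 1 ≤ m) (hA : (m : ℝ) ≤ A) {p : ℝ[X]}
    (hp : p = (limitBidiagonal A m * (limitBidiagonal A m)ᵀ).charpoly) :
    X * derivative (derivative p) + (C (A - m + 1) - X) * derivative p + C (m : ℝ) * p = 0 := by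
  obtain ⟨a, ha⟩ := charpoly_limit_gram hm hA
  rw [hp, ha]
  simp only [derivative_mul, derivative_C, zero_mul, zero_add]
  linear_combination (C a) * laguerreDiff_ode (A - m + 1) m

/-- The logarithmic derivative `T = p'/p` satisfies `p'' = (T' + T²) p`, which turns the linear
second-order equation for `p` into a Riccati equation for `T`. -/
theorem riccati_of_ode {m : ℕ} {μ : Fin m → ℝ} {α : ℝ} {p : ℝ[X]}
    (hp : p = ∏ i, (X - C (μ i)))
    (hode : X * derivative (derivative p) + (C α - X) * derivative p + C (m : ℝ) * p = 0)
    {z : ℂ} (hz : 0 < z.im) :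
    z * ((∑ i, 1 / (z - μ i)) ^ 2 - ∑ i, 1 / (z - μ i) ^ 2) +
      (α - z) * (∑ i, 1 / (z - μ i)) + m = 0 := by
  set P : ℂ[X] := p.map Complex.ofRealHom with hP
  have hPeval : ∀ w : ℂ, P.eval w = ∏ i, (w - μ i) := by
    intro w
    rw [hP, hp, Polynomial.map_prod, eval_prod]
    simp
  have hne : ∀ w : ℂ, 0 < w.im → ∀ i, w - μ i ≠ 0 := fun w hw i h =>
    ofReal_sub_ne_zero hw (μ i) (by rw [← neg_sub, h, neg_zero])
  have hP0 : ∀ w : ℂ, 0 < w.im → P.eval w ≠ 0 := fun w hw => by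
    rw [hPeval]
    exact Finset.prod_ne_zero_iff.mpr fun i _ => hne w hw i
  set T : ℂ → ℂ := fun w => ∑ i, 1 / (w - μ i) with hT
  have h1 : ∀ w : ℂ, 0 < w.im → (derivative P).eval w = T w * P.eval w := by
    intro w hw
    have hd := P.hasDerivAt w
    have hprod : HasDerivAt (fun w => P.eval w)
        (∑ i, (∏ j ∈ Finset.univ.erase i, (w - μ j)) • (1 : ℂ)) w := by
      have := HasDerivAt.fun_finsetProd (u := Finset.univ) (f := fun i (w : ℂ) => w - (μ i : ℂ))
        (f' := fun _ => 1) (x := w) fun i _ => (hasDerivAt_id w).sub_const _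
      simpa only [hPeval] using! this
    rw [hd.unique hprod, hT, Finset.sum_mul]
    refine Finset.sum_congr rfl fun i _ => ?_
    rw [hPeval, ← Finset.mul_prod_erase _ _ (Finset.mem_univ i)]
    have := hne w hw i
    rw [smul_eq_mul]
    field_simp
  have hT' : HasDerivAt T (-∑ i, 1 / (z - μ i) ^ 2) z := by
    rw [← Finset.sum_neg_distrib]
    apply HasDerivAt.fun_sum
    intro i _
    have := ((hasDerivAt_id z).sub_const (μ i : ℂ)).inv (hne z hz i)
    simpa [neg_div] using! this
  have h2 : (derivative (derivative P)).eval z =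
      (-∑ i, 1 / (z - μ i) ^ 2) * P.eval z + T z * (T z * P.eval z) := by
    have hd := (derivative P).hasDerivAt z
    have hd2 : HasDerivAt (fun w => (derivative P).eval w)
        ((-∑ i, 1 / (z - μ i) ^ 2) * P.eval z + T z * (derivative P).eval z) z := by
      refine (hT'.mul (P.hasDerivAt z)).congr_of_eventuallyEq ?_
      have : ∀ᶠ w : ℂ in nhds z, 0 < w.im :=
        (isOpen_lt continuous_const Complex.continuous_im).mem_nhds hz
      filter_upwards [this] with w hw using h1 w hw
    rw [hd.unique hd2, h1 z hz]
  have hodeC := congrArg (fun q : ℝ[X] => (q.map Complex.ofRealHom).eval z) hode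
  simp only [Polynomial.map_add, Polynomial.map_mul, Polynomial.map_sub, map_X, map_C,
    ← derivative_map, eval_add, eval_mul, eval_sub, eval_X, eval_C, Polynomial.map_zero,
    eval_zero, ← hP, h1 z hz, h2] at hodeC
  apply mul_right_cancel₀ (hP0 z hz)
  rw [zero_mul, ← hodeC]
  simp only [hT, Complex.ofRealHom_eq_coe, Complex.ofReal_natCast]
  ring

end Laguerre

end BetaLaguerre

namespace BetaLaguerre

/-! ### The Stieltjes transform of the Marchenko–Pastur distribution -/

section MarchenkoPastur

open Set

/-- The integral of `sin² θ / ((1 - q e^{iθ}) (1 - q e^{-iθ}))`. For `‖q‖ < 1` the integrand is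
`h(e^{iθ}) + h(e^{-iθ})` with `h` holomorphic on the closed disc, and the mean value property
applies. The boundary value `q = -1` is needed for `d = 1`. -/
theorem integral_sin_sq_div {q : ℂ} (hq : ‖q‖ < 1 ∨ q = -1) :
    IntegrableOn (fun θ : ℝ => (Real.sin θ : ℂ) ^ 2 / (1 - 2 * q * Real.cos θ + q ^ 2))
        (Ioo 0 Real.pi) ∧
      ∫ θ in Ioo 0 Real.pi, (Real.sin θ : ℂ) ^ 2 / (1 - 2 * q * Real.cos θ + q ^ 2) =
        (Real.pi : ℂ) / 2 := by
  rcases hq with hq | rfl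
  · have hne : ∀ w : ℂ, ‖w‖ ≤ 1 → 1 - q * w ≠ 0 := by
      intro w hw h
      have h1 : q * w = 1 := (sub_eq_zero.mp h).symm
      have h2 : ‖q‖ * ‖w‖ = 1 := by rw [← norm_mul, h1, norm_one]
      nlinarith [norm_nonneg q, norm_nonneg w]
    set h : ℂ → ℂ := fun w => -(w ^ 2 - 1) / (4 * (1 - q * w)) with hh
    have hdiff : DifferentiableOn ℂ h (closure (Metric.ball 0 |(1 : ℝ)|)) := by
      intro w hw
      have hw1 : ‖w‖ ≤ 1 := by
        have := Metric.closure_ball_subset_closedBall hw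
        simpa using this
      refine DifferentiableAt.differentiableWithinAt ?_
      exact ((by fun_prop : DifferentiableAt ℂ (fun w : ℂ => -(w ^ 2 - 1)) w)).div
        (by fun_prop) (mul_ne_zero (by norm_num) (hne w hw1))
    have havg := hdiff.diffContOnCl.circleAverage
    rw [Real.circleAverage] at havg
    set g : ℝ → ℂ := fun θ => h (circleMap 0 1 θ) with hg
    have hnorm : ∀ θ : ℝ, ‖circleMap 0 1 θ‖ = 1 := by simp
    have hgcont : Continuous g := by
      rw [continuous_iff_continuousAt]
      intro θ
      have h1 : ContinuousAt h (circleMap 0 1 θ) := by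
        refine ContinuousAt.div (by fun_prop) (by fun_prop) ?_
        exact mul_ne_zero (by norm_num) (hne _ (hnorm θ).le)
      exact ContinuousAt.comp h1 (continuous_circleMap 0 1).continuousAt
    have hfg : ∀ θ : ℝ, (Real.sin θ : ℂ) ^ 2 / (1 - 2 * q * Real.cos θ + q ^ 2) =
        g θ + g (-θ) := by
      intro θ
      have hw : circleMap 0 1 θ = Complex.exp (θ * Complex.I) := by simp [circleMap]
      have hw' : circleMap 0 1 (-θ) = (Complex.exp (θ * Complex.I))⁻¹ := by
        simp [circleMap, ← Complex.exp_neg]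
      have hn1 := hne _ (hnorm θ).le
      have hn2 := hne _ (hnorm (-θ)).le
      simp only [hg, hh]
      rw [Complex.ofReal_sin, Complex.ofReal_cos, Complex.sin, Complex.cos]
      rw [hw] at hn1 ⊢
      rw [hw'] at hn2 ⊢
      rw [neg_mul, Complex.exp_neg]
      have hw0 := Complex.exp_ne_zero (θ * Complex.I)
      set w := Complex.exp (θ * Complex.I)
      have hD : 1 - 2 * q * ((w + w⁻¹) / 2) + q ^ 2 = (1 - q * w) * (1 - q * w⁻¹) := by
        field_simp
        ring
      rw [hD]
      have hs : ((w⁻¹ - w) * Complex.I / 2) ^ 2 = -(w⁻¹ - w) ^ 2 / 4 := by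
        rw [div_pow, mul_pow, Complex.I_sq]
        ring
      have hn3 : w - q ≠ 0 := by
        intro h3
        apply hn2
        rw [sub_eq_zero.mp h3] at hw0 ⊢
        rw [mul_inv_cancel₀ hw0, sub_self]
      have hn4 : 1 - q * w⁻¹ = (w - q) / w := by field_simp
      have hn5 : 1 - w * q ≠ 0 := by rwa [mul_comm w q]
      rw [hs, hn4, mul_comm q w]
      field_simp
      ring
    have hgneg : Continuous fun θ => g (-θ) := hgcont.comp continuous_neg
    simp only [hfg]
    refine ⟨((hgcont.add hgneg).integrableOn_Icc).mono_set Ioo_subset_Icc_self, ?_⟩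
    rw [← integral_Ioc_eq_integral_Ioo, ← intervalIntegral.integral_of_le Real.pi_pos.le,
      intervalIntegral.integral_add (hgcont.intervalIntegrable _ _)
        (hgneg.intervalIntegrable _ _),
      intervalIntegral.integral_comp_neg g, neg_zero, add_comm,
      intervalIntegral.integral_add_adjacent_intervals (hgcont.intervalIntegrable _ _)
        (hgcont.intervalIntegrable _ _)]
    have hper : Function.Periodic g (2 * Real.pi) := fun θ => by
      simp only [hg, periodic_circleMap 0 1 θ]
    have h2 := hper.intervalIntegral_add_eq (-Real.pi) 0
    rw [show -Real.pi + 2 * Real.pi = Real.pi by ring, zero_add] at h2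
    rw [h2]
    have hpi : (Real.pi : ℂ) ≠ 0 := by exact_mod_cast Real.pi_ne_zero
    rw [inv_smul_eq_iff₀ (by positivity)] at havg
    rw [hg, havg]
    simp [hh]
    ring
  · have hpt : ∀ θ ∈ Ioo 0 Real.pi,
        (((1 - Real.cos θ) / 2 : ℝ) : ℂ) =
          (Real.sin θ : ℂ) ^ 2 / (1 - 2 * (-1) * Real.cos θ + (-1) ^ 2) := by
      intro θ hθ
      have hcos : -1 < Real.cos θ := by
        rw [← Real.cos_pi]
        exact Real.cos_lt_cos_of_nonneg_of_le_pi hθ.1.le le_rfl hθ.2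
      have h1 : Real.sin θ ^ 2 / (1 - 2 * (-1) * Real.cos θ + (-1) ^ 2) =
          (1 - Real.cos θ) / 2 := by
        rw [Real.sin_sq, div_eq_div_iff (by linarith) (by norm_num)]
        ring
      rw [← h1]
      push_cast
      rfl
    have hcont : Continuous fun θ : ℝ => (((1 - Real.cos θ) / 2 : ℝ) : ℂ) := by fun_prop
    constructor
    · refine IntegrableOn.congr_fun ?_ hpt measurableSet_Ioo
      exact (hcont.integrableOn_Icc).mono_set Ioo_subset_Icc_self
    · rw [← setIntegral_congr_fun measurableSet_Ioo hpt, integral_complex_ofReal,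
        ← integral_Ioc_eq_integral_Ioo, ← intervalIntegral.integral_of_le Real.pi_pos.le,
        intervalIntegral.integral_div, intervalIntegral.integral_sub (by simp)
          (Real.continuous_cos.intervalIntegrable _ _)]
      simp

theorem image_cos_Ioo {r : ℝ} (hr : 0 < r) :
    (fun θ : ℝ => 1 + r ^ 2 + 2 * r * Real.cos θ) '' Ioo 0 Real.pi =
      Ioo ((1 - r) ^ 2) ((1 + r) ^ 2) := by
  ext x
  constructor
  · rintro ⟨θ, hθ, rfl⟩
    have h1 : -1 < Real.cos θ := by
      rw [← Real.cos_pi]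
      exact Real.cos_lt_cos_of_nonneg_of_le_pi hθ.1.le le_rfl hθ.2
    have h2 : Real.cos θ < 1 := by
      rw [← Real.cos_zero]
      exact Real.cos_lt_cos_of_nonneg_of_le_pi le_rfl hθ.2.le hθ.1
    constructor <;> dsimp only <;> nlinarith
  · rintro ⟨h1, h2⟩
    have h3 : -1 < (x - (1 + r ^ 2)) / (2 * r) := by
      rw [lt_div_iff₀ (by positivity)]
      nlinarith
    have h4 : (x - (1 + r ^ 2)) / (2 * r) < 1 := by
      rw [div_lt_iff₀ (by positivity)]
      nlinarith
    refine ⟨Real.arccos ((x - (1 + r ^ 2)) / (2 * r)), ⟨Real.arccos_pos.mpr h4, ?_⟩, ?_⟩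
    · exact lt_of_le_of_ne (Real.arccos_le_pi _) fun h => by
        rw [Real.arccos_eq_pi] at h
        linarith
    · dsimp only
      rw [Real.cos_arccos h3.le h4.le]
      field_simp
      ring

/-- The substitution `x = |1 + r e^{iθ}|²`, with `r = √d`. -/
theorem mpStieltjes_eq_integral {r : ℝ} (hr : 0 < r) (z : ℂ) :
    mpStieltjes (r ^ 2) z = 2 / Real.pi * ∫ θ in Ioo 0 Real.pi, (Real.sin θ : ℂ) ^ 2 /
      ((1 + r ^ 2 + 2 * r * Real.cos θ) * (1 + r ^ 2 + 2 * r * Real.cos θ - z)) := by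
  have hs : Real.sqrt (r ^ 2) = r := Real.sqrt_sq hr.le
  have hm : lambdaMinus (r ^ 2) = (1 - r) ^ 2 := by rw [lambdaMinus, hs]
  have hp : lambdaPlus (r ^ 2) = (1 + r) ^ 2 := by rw [lambdaPlus, hs]
  have h1 : mpStieltjes (r ^ 2) z = ∫ x : ℝ in Ioo ((1 - r) ^ 2) ((1 + r) ^ 2),
      1 / ((x : ℂ) - z) * (mpDensity (r ^ 2) x : ℂ) := by
    rw [← integral_Icc_eq_integral_Ioo, mpStieltjes]
    refine (setIntegral_eq_integral_of_forall_compl_eq_zero fun x hx => ?_).symm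
    rw [mpDensity, if_neg (by rw [hm, hp]; exact hx), Complex.ofReal_zero, mul_zero]
  rw [h1, ← image_cos_Ioo hr, integral_image_eq_integral_abs_deriv_smul measurableSet_Ioo
    (f' := fun θ => 2 * r * -Real.sin θ)
    (fun θ _ => (((Real.hasDerivAt_cos θ).const_mul (2 * r)).const_add _).hasDerivWithinAt),
    ← integral_const_mul]
  · refine setIntegral_congr_fun measurableSet_Ioo fun θ hθ => ?_
    have hsin : 0 < Real.sin θ := Real.sin_pos_of_mem_Ioo hθ
    have hx : 1 + r ^ 2 + 2 * r * Real.cos θ ∈ Ioo ((1 - r) ^ 2) ((1 + r) ^ 2) := by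
      rw [← image_cos_Ioo hr]
      exact ⟨θ, hθ, rfl⟩
    have hx0 : 0 < 1 + r ^ 2 + 2 * r * Real.cos θ := lt_of_le_of_lt (sq_nonneg _) hx.1
    have hsq : ((1 + r) ^ 2 - (1 + r ^ 2 + 2 * r * Real.cos θ)) *
        ((1 + r ^ 2 + 2 * r * Real.cos θ) - (1 - r) ^ 2) = (2 * r * Real.sin θ) ^ 2 := by
      rw [mul_pow, Real.sin_sq]
      ring
    have hdens : |2 * r * -Real.sin θ| * mpDensity (r ^ 2) (1 + r ^ 2 + 2 * r * Real.cos θ) =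
        2 / Real.pi * (Real.sin θ ^ 2 / (1 + r ^ 2 + 2 * r * Real.cos θ)) := by
      rw [mpDensity, hm, hp, if_pos ⟨hx.1.le, hx.2.le⟩, hsq, Real.sqrt_sq (by positivity),
        mul_neg, abs_neg, abs_of_pos (by positivity)]
      have := Real.pi_pos
      field_simp
    have hdensC := congrArg (fun t : ℝ => (t : ℂ)) hdens
    simp only [Complex.ofReal_mul] at hdensC
    rw [Complex.real_smul, mul_left_comm, hdensC]
    push_cast
    rw [← div_div ((Complex.sin θ) ^ 2)]
    ring
  · intro a ha b hb hab
    dsimp only at hab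
    have h2 : Real.cos a = Real.cos b := by
      have h3 : 2 * r * Real.cos a = 2 * r * Real.cos b := by linarith
      exact mul_left_cancel₀ (by positivity) h3
    exact Real.injOn_cos (Ioo_subset_Icc_self ha) (Ioo_subset_Icc_self hb) h2

/-- Closed form of the Marchenko–Pastur Stieltjes transform in the uniformizing parameter `q`,
where `z = (1 + r q) (r + q) / q` and `r = √d`. -/
theorem mpStieltjes_eq {r : ℝ} (hr : 0 < r) (hr1 : r ≤ 1) {z q : ℂ} (hz : 0 < z.im)
    (hq1 : ‖q‖ < 1) (hq0 : q ≠ 0) (hzq : z = 1 + r ^ 2 + r * (q + 1 / q)) :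
    mpStieltjes (r ^ 2) z = -q / (r * (1 + r * q)) := by
  have hrC : (r : ℂ) ≠ 0 := by exact_mod_cast hr.ne'
  have hz0 : z ≠ 0 := by
    rintro rfl
    simp at hz
  have hzfac : z * q = (1 + r * q) * (r + q) := by
    rw [hzq]
    field_simp
    ring
  have hfac1 : 1 + r * q ≠ 0 := fun h => by
    rw [h, zero_mul] at hzfac
    exact mul_ne_zero hz0 hq0 hzfac
  have hfac2 : r + q ≠ 0 := fun h => by
    rw [h, mul_zero] at hzfac
    exact mul_ne_zero hz0 hq0 hzfac
  have hr' : ‖(-(r : ℂ))‖ < 1 ∨ -(r : ℂ) = -1 := by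
    rcases hr1.lt_or_eq with h | h
    · left
      rwa [norm_neg, Complex.norm_real, Real.norm_eq_abs, abs_of_pos hr]
    · right
      rw [h, Complex.ofReal_one]
  obtain ⟨hi1, he1⟩ := integral_sin_sq_div (q := q) (Or.inl hq1)
  obtain ⟨hi2, he2⟩ := integral_sin_sq_div hr'
  -- Partial fractions for `1 / (x (x - z))`: the factor `x` corresponds to the parameter `-r`, and
  -- `x - z` to the parameter `q`.
  have hpt : ∀ θ ∈ Ioo 0 Real.pi, (Real.sin θ : ℂ) ^ 2 /
      ((1 + r ^ 2 + 2 * r * Real.cos θ) * (1 + r ^ 2 + 2 * r * Real.cos θ - z)) =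
      (-(q / r) / z) * ((Real.sin θ : ℂ) ^ 2 / (1 - 2 * q * Real.cos θ + q ^ 2)) -
      (1 / z) * ((Real.sin θ : ℂ) ^ 2 / (1 - 2 * (-r) * Real.cos θ + (-r) ^ 2)) := by
    intro θ hθ
    have hx : 1 + r ^ 2 + 2 * r * Real.cos θ ∈ Ioo ((1 - r) ^ 2) ((1 + r) ^ 2) := by
      rw [← image_cos_Ioo hr]
      exact ⟨θ, hθ, rfl⟩
    have hx0 : ((1 + r ^ 2 + 2 * r * Real.cos θ : ℝ) : ℂ) ≠ 0 := by
      exact_mod_cast (lt_of_le_of_lt (sq_nonneg _) hx.1).ne'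
    have hxz := ofReal_sub_ne_zero hz (1 + r ^ 2 + 2 * r * Real.cos θ)
    push_cast at hx0 hxz
    have e1 : 1 - 2 * (-r : ℂ) * Real.cos θ + (-r) ^ 2 = 1 + r ^ 2 + 2 * r * Complex.cos θ := by
      push_cast
      ring
    have e2 : 1 - 2 * q * Real.cos θ + q ^ 2 =
        -(q / r) * (1 + r ^ 2 + 2 * r * Complex.cos θ - z) := by
      rw [hzq]
      push_cast
      field_simp
      ring
    rw [e1, e2]
    push_cast
    have hqr : -(q / r) ≠ 0 := neg_ne_zero.mpr (div_ne_zero hq0 hrC)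
    set x : ℂ := 1 + r ^ 2 + 2 * r * Complex.cos θ
    have e3 : (-(q / r) / z) * (Complex.sin θ ^ 2 / (-(q / r) * (x - z))) =
        1 / z * (Complex.sin θ ^ 2 / (x - z)) := by
      field_simp
    rw [e3]
    field_simp
    ring
  rw [mpStieltjes_eq_integral hr, setIntegral_congr_fun measurableSet_Ioo hpt,
    integral_sub (hi1.const_mul _) (hi2.const_mul _), integral_const_mul, integral_const_mul,
    he1, he2]
  have hpi : (Real.pi : ℂ) ≠ 0 := by exact_mod_cast Real.pi_ne_zero
  have hz' : z = (1 + r * q) * (r + q) / q := by rw [← hzfac, mul_div_cancel_right₀ _ hq0]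
  rw [hz']
  field_simp
  ring

/-- The two solutions `q` of the quadratic equation have product `1`, and they cannot lie on the unit
circle because `q + 1/q` would be real there. -/
theorem exists_uniformizer {r : ℝ} (hr : 0 < r) {z : ℂ} (hz : 0 < z.im) :
    ∃ q : ℂ, q ≠ 0 ∧ ‖q‖ < 1 ∧ z = 1 + r ^ 2 + r * (q + 1 / q) := by
  have hrC : (r : ℂ) ≠ 0 := by exact_mod_cast hr.ne'
  set b : ℂ := (z - (1 + r ^ 2)) / r with hb
  obtain ⟨t, ht⟩ := IsAlgClosed.exists_pow_nat_eq (b ^ 2 - 4) (n := 2) (by norm_num)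
  have key : ∀ p : ℂ, p ≠ 0 → p + 1 / p = b → z = 1 + r ^ 2 + r * (p + 1 / p) := by
    intro p _ h
    rw [h, hb]
    field_simp
    ring
  set p := (b + t) / 2 with hp
  have hprod : p * ((b - t) / 2) = 1 := by
    rw [hp]
    linear_combination -ht / 4
  have hp0 : p ≠ 0 := left_ne_zero_of_mul_eq_one hprod
  have hinv : 1 / p = (b - t) / 2 := by
    rw [eq_comm, eq_div_iff hp0, mul_comm]
    exact hprod
  have hsum : p + 1 / p = b := by rw [hinv, hp]; ring
  rcases lt_trichotomy ‖p‖ 1 with h | h | h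
  · exact ⟨p, hp0, h, key p hp0 hsum⟩
  · exfalso
    have h1 : p + 1 / p = (2 * p.re : ℝ) := by
      rw [one_div, Complex.inv_def, Complex.normSq_eq_norm_sq, h]
      simp only [one_pow, inv_one, Complex.ofReal_one, mul_one]
      exact Complex.add_conj p
    have h2 := key p hp0 hsum
    rw [h1] at h2
    have h3 := congrArg Complex.im h2
    rw [show (1 + (r : ℂ) ^ 2 + r * ((2 * p.re : ℝ) : ℂ)) =
      ((1 + r ^ 2 + r * (2 * p.re) : ℝ) : ℂ) by push_cast; ring, Complex.ofReal_im] at h3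
    exact hz.ne' h3
  · refine ⟨1 / p, one_div_ne_zero hp0, ?_, key _ (one_div_ne_zero hp0) ?_⟩
    · rw [norm_div, norm_one, div_lt_one (by linarith)]
      exact h
    · rw [one_div_one_div, add_comm]
      exact hsum

/-- In the bulk, an approximate solution of the Marchenko–Pastur quadratic equation in the upper
half-plane is close to the Stieltjes transform. The second root lies in the lower half-plane, at a
distance that the bulk condition bounds from below. -/
theorem norm_sub_mpStieltjes_le {d κ : ℝ} (hd : 0 < d) (hd1 : d ≤ 1) (hκ : 0 < κ) {z s E : ℂ}
    (hz : 0 < z.im) (hz1 : lambdaMinus d + κ < z.re) (hz2 : z.re < lambdaPlus d - κ)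
    (hs : 0 ≤ s.im) (hE : d * z * s ^ 2 + (z + d - 1) * s + 1 = E) :
    ‖s - mpStieltjes d z‖ ≤ 16 / κ ^ 3 * ‖E‖ := by
  obtain ⟨r, hr, rfl⟩ : ∃ r : ℝ, 0 < r ∧ d = r ^ 2 :=
    ⟨Real.sqrt d, Real.sqrt_pos.mpr hd, (Real.sq_sqrt hd.le).symm⟩
  have hr1 : r ≤ 1 := by nlinarith
  rw [lambdaMinus, Real.sqrt_sq hr.le] at hz1
  rw [lambdaPlus, Real.sqrt_sq hr.le] at hz2
  have hrκ : κ / 2 < r := by nlinarith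
  obtain ⟨q, hq0, hq1, hzq⟩ := exists_uniformizer hr hz
  rw [mpStieltjes_eq hr hr1 hz hq1 hq0 hzq]
  have hrC : (r : ℂ) ≠ 0 := by exact_mod_cast hr.ne'
  have hz0 : z ≠ 0 := by
    rintro rfl
    simp at hz
  have hzfac : z * q = (1 + r * q) * (r + q) := by
    rw [hzq]
    field_simp
    ring
  have hfac1 : 1 + r * q ≠ 0 := fun h => by
    rw [h, zero_mul] at hzfac
    exact mul_ne_zero hz0 hq0 hzfac
  have hfac2 : r + q ≠ 0 := fun h => by
    rw [h, mul_zero] at hzfac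
    exact mul_ne_zero hz0 hq0 hzfac
  have hz' : z = (1 + r * q) * (r + q) / q := by rw [← hzfac, mul_div_cancel_right₀ _ hq0]
  have hroots : r ^ 2 * z * ((s - -q / (r * (1 + r * q))) * (s - -1 / (r * (r + q)))) = E := by
    rw [← hE, hz']
    push_cast
    field_simp
    ring
  have hnq : 0 < ‖q‖ := norm_pos_iff.mpr hq0
  have hnsq : Complex.normSq q = ‖q‖ ^ 2 := Complex.normSq_eq_norm_sq q
  have hzq' : z = ((1 + r ^ 2 : ℝ) : ℂ) + r * (q + (starRingEnd ℂ) q * ((1 / ‖q‖ ^ 2 : ℝ) : ℂ)) := by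
    rw [hzq, one_div q, Complex.inv_def, hnsq]
    push_cast
    rw [one_div]
  have him : z.im = r * q.im * (1 - 1 / ‖q‖ ^ 2) := by
    rw [hzq', Complex.add_im, Complex.im_ofReal_mul, Complex.add_im, Complex.im_mul_ofReal,
      Complex.ofReal_im, Complex.conj_im]
    ring
  have hre : z.re = 1 + r ^ 2 + r * (q.re * (1 + 1 / ‖q‖ ^ 2)) := by
    rw [hzq', Complex.add_re, Complex.re_ofReal_mul, Complex.add_re, Complex.re_mul_ofReal,
      Complex.ofReal_re, Complex.conj_re]
    ring
  have hqim : q.im < 0 := by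
    have h1 : 1 - 1 / ‖q‖ ^ 2 < 0 := by
      rw [sub_neg, lt_div_iff₀ (by positivity)]
      nlinarith
    by_contra h
    push Not at h
    have : r * q.im * (1 - 1 / ‖q‖ ^ 2) ≤ 0 :=
      mul_nonpos_of_nonneg_of_nonpos (by positivity) h1.le
    linarith
  -- The bulk condition on `Re z` keeps the argument of `q` away from `0` and `π`.
  have hqre : |q.re| ≤ (1 - κ / 2) * ‖q‖ := by
    have h1 : 2 / ‖q‖ ≤ 1 + 1 / ‖q‖ ^ 2 := by
      have : 0 ≤ (1 - 1 / ‖q‖) ^ 2 := sq_nonneg _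
      have e : (1 - 1 / ‖q‖) ^ 2 = 1 + 1 / ‖q‖ ^ 2 - 2 / ‖q‖ := by
        field_simp
        ring
      linarith
    have h2 : r * (|q.re| * (1 + 1 / ‖q‖ ^ 2)) ≤ 2 * r - κ := by
      have h3 : r * (|q.re| * (1 + 1 / ‖q‖ ^ 2)) = |r * (q.re * (1 + 1 / ‖q‖ ^ 2))| := by
        rw [abs_mul, abs_mul, abs_of_pos hr, abs_of_pos (by positivity : 0 < 1 + 1 / ‖q‖ ^ 2)]
      rw [h3, abs_le]
      constructor <;> linarith
    have h4 : r * (|q.re| * (2 / ‖q‖)) ≤ 2 * r - κ :=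
      le_trans (by gcongr) h2
    have h5 : r * |q.re| * 2 ≤ (2 * r - κ) * ‖q‖ := by
      have : r * (|q.re| * (2 / ‖q‖)) = r * |q.re| * 2 / ‖q‖ := by ring
      rwa [this, div_le_iff₀ hnq] at h4
    have h6 : κ * r * ‖q‖ ≤ κ * ‖q‖ := by nlinarith [mul_pos hκ hnq]
    have h7 : r * |q.re| ≤ r * ((1 - κ / 2) * ‖q‖) := by nlinarith
    exact le_of_mul_le_mul_left h7 hr
  have hqim' : κ / 2 * ‖q‖ ≤ -q.im := by
    have := Complex.norm_le_abs_re_add_abs_im q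
    rw [abs_of_neg hqim] at this
    linarith
  have hκ2 : κ / 2 ≤ 1 := by linarith
  have hn1 : κ / 2 ≤ ‖1 + r * q‖ := by
    have h1 := Complex.re_le_norm (1 + r * q)
    have h2 : (1 + r * q : ℂ).re = 1 + r * q.re := by simp
    rw [h2] at h1
    have h3 : |q.re| ≤ 1 - κ / 2 := hqre.trans (by nlinarith)
    have h4 := (abs_le.mp h3).1
    nlinarith [neg_abs_le q.re, abs_nonneg q.re]
  have hn2 : ‖r + q‖ ≤ 2 := by
    refine (norm_add_le _ _).trans ?_
    rw [Complex.norm_real, Real.norm_eq_abs, abs_of_pos hr]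
    linarith
  have hn2' : 0 < ‖r + q‖ := norm_pos_iff.mpr hfac2
  have hsep : -q.im / (r * ‖r + q‖ ^ 2) ≤ ‖s - -1 / (r * (r + q))‖ := by
    refine le_trans ?_ ((le_abs_self _).trans (Complex.abs_im_le_norm _))
    have h1 : (-1 / (r * (r + q)) : ℂ) = ((-1 / (r * ‖r + q‖ ^ 2) : ℝ) : ℂ) *
        (starRingEnd ℂ) (r + q) := by
      have h2 : (r + q) * (starRingEnd ℂ) (r + q) = (‖r + q‖ : ℂ) ^ 2 := Complex.mul_conj' _
      have h3 : (‖r + q‖ : ℂ) ≠ 0 := by exact_mod_cast hn2'.ne'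
      push_cast
      field_simp
      rw [← h2]
    rw [Complex.sub_im, h1, Complex.im_ofReal_mul]
    simp only [map_add, Complex.conj_ofReal, Complex.add_im, Complex.ofReal_im, Complex.conj_im,
      zero_add]
    have h4 : -1 / (r * ‖r + q‖ ^ 2) * -q.im = -(-q.im / (r * ‖r + q‖ ^ 2)) := by ring
    rw [h4]
    linarith
  have hnz : ‖z‖ = ‖1 + r * q‖ * ‖r + q‖ / ‖q‖ := by
    rw [hz', norm_div, norm_mul]
  have hlow : κ ^ 3 / 16 ≤ r ^ 2 * ‖z‖ * ‖s - -1 / (r * (r + q))‖ := by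
    calc κ ^ 3 / 16 = κ / 2 * (κ / 2) * (κ / 2) / 2 := by ring
      _ ≤ r * ‖1 + r * q‖ * (-q.im / ‖q‖) / ‖r + q‖ := by
          have h1 : κ / 2 ≤ -q.im / ‖q‖ := by rwa [le_div_iff₀ hnq]
          have h2 : 0 ≤ -q.im / ‖q‖ := le_trans (by positivity) h1
          gcongr
      _ = r ^ 2 * ‖z‖ * (-q.im / (r * ‖r + q‖ ^ 2)) := by
          rw [hnz]
          field_simp
      _ ≤ _ := by gcongr
  have hnorm := congrArg norm hroots
  rw [norm_mul, norm_mul, norm_mul, norm_pow, Complex.norm_real, Real.norm_eq_abs,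
    abs_of_pos hr] at hnorm
  have hfin : ‖s - -q / (r * (1 + r * q))‖ * (κ ^ 3 / 16) ≤ ‖E‖ := by
    rw [← hnorm]
    calc _ ≤ ‖s - -q / (r * (1 + r * q))‖ * (r ^ 2 * ‖z‖ * ‖s - -1 / (r * (r + q))‖) := by gcongr
      _ = _ := by ring
  rw [div_mul_eq_mul_div, le_div_iff₀ (by positivity)]
  linarith

end MarchenkoPastur

end BetaLaguerre

namespace BetaLaguerre

open Matrix

/-! ### Comparison of the deterministic matrix with the Marchenko–Pastur law -/

section Deterministic

variable {m : ℕ}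

theorem limitMatrix_eq {d : ℝ} (hd : 0 < d) (hd1 : d ≤ 1) (m : ℕ) :
    limitMatrix d m =
      (d / m) • (limitBidiagonal (m / d) m * (limitBidiagonal (m / d) m)ᵀ) := by
  rw [limitMatrix]
  congr 1
  ext i j
  have h := sum_bidiagonal_row (fun i : Fin m => Real.sqrt ((m : ℝ) / d - (i : ℕ)))
    (fun j => Real.sqrt ((m : ℝ) - 1 - (j : ℕ))) (fun k => limitBidiagonal (m / d) m j k) i
  simp only [smul_eq_mul] at h
  rw [Matrix.mul_apply]
  simp only [Matrix.transpose_apply]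
  simp only [limitBidiagonal] at h ⊢
  rw [h]
  have hcast : ∀ k : ℕ, 0 < k → ((k - 1 : ℕ) : ℝ) = k - 1 := fun k hk => by
    rw [Nat.cast_sub hk, Nat.cast_one]
  have hm1 : ∀ k : Fin m, (0 : ℝ) ≤ (m : ℝ) - k := fun k => by
    have : ((k : ℕ) : ℝ) ≤ m := by exact_mod_cast k.isLt.le
    linarith
  have hA : ∀ k : Fin m, (0 : ℝ) ≤ (m : ℝ) / d - k := fun k => by
    have h1 : (m : ℝ) ≤ m / d := by
      rw [le_div_iff₀ hd]
      exact mul_le_of_le_one_right (Nat.cast_nonneg _) hd1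
    linarith [hm1 k]
  simp only [bidiagonal, Matrix.of_apply]
  by_cases h1 : i = j
  · subst h1
    rw [if_pos rfl, if_pos rfl, Real.mul_self_sqrt (hA i)]
    by_cases h2 : (i : ℕ) = 0
    · rw [if_pos h2, dif_neg (by omega), h2]
      simp
    · have h3 : 0 < (i : ℕ) := by omega
      rw [if_neg h2, dif_pos h3, if_neg (by rw [Fin.ext_iff]; dsimp only; omega),
        dif_pos (by omega), hcast _ h3, Real.mul_self_sqrt (by linarith [hm1 i])]
      ring
  · have h1' : (i : ℕ) ≠ j := fun h => h1 (Fin.ext h)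
    rw [if_neg h1, if_neg (Ne.symm h1)]
    by_cases h2 : (j : ℕ) = i + 1
    · rw [if_pos h2, dif_pos h2]
      split_ifs with h3 h4 h5
      · rw [Fin.ext_iff] at h4; dsimp only at h4; omega
      · omega
      · ring
      · ring
    · rw [if_neg h2, dif_neg h2, mul_zero, zero_add]
      by_cases h3 : (i : ℕ) = j + 1
      · have h4 : (i : ℕ) - 1 = j := by omega
        rw [if_pos h3, dif_pos (by omega), if_pos (by rw [Fin.ext_iff]; dsimp only; omega), h4]
        ring
      · rw [if_neg h3]
        split_ifs with h4 h5 h6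
        · rw [Fin.ext_iff] at h5; dsimp only at h5; omega
        · omega
        · ring
        · rfl

theorem resolventTrace_smul {H : Matrix (Fin m) (Fin m) ℝ} (hH : H.IsHermitian) {c : ℝ}
    (hc : 0 < c) {z : ℂ} (hz : 0 < z.im) :
    resolventTrace (c • H) z = (c : ℂ)⁻¹ * resolventTrace H (z / c) := by
  have hcC : (c : ℂ) ≠ 0 := by exact_mod_cast hc.ne'
  have hz' : 0 < (z / c).im := by
    rw [Complex.div_ofReal_im]
    positivity
  obtain ⟨-, -, -, hA, -⟩ := resolvent_spectral hH hz'
  have h1 : ((c • H).map fun t : ℝ => (t : ℂ)) - z • (1 : Matrix (Fin m) (Fin m) ℂ) =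
      (c : ℂ) • ((H.map fun t : ℝ => (t : ℂ)) - (z / c) • (1 : Matrix (Fin m) (Fin m) ℂ)) := by
    rw [smul_sub, smul_smul, mul_div_cancel₀ _ hcC]
    congr 1
    ext i j
    simp
  have h2 : (((c • H).map fun t : ℝ => (t : ℂ)) - z • (1 : Matrix (Fin m) (Fin m) ℂ))⁻¹ =
      (c : ℂ)⁻¹ • resolventMatrix H (z / c) := by
    apply Matrix.inv_eq_right_inv
    rw [h1, Matrix.smul_mul, Matrix.mul_smul, hA, smul_smul, mul_inv_cancel₀ hcC, one_smul]
  rw [resolventTrace, resolventTrace, h2, trace_smul, smul_eq_mul]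
  change _ = _ * (_ * (resolventMatrix H (z / c)).trace)
  ring

theorem resolventTrace_im_nonneg {M : Matrix (Fin m) (Fin m) ℝ} (hM : M.IsHermitian) {z : ℂ}
    (hz : 0 < z.im) : 0 ≤ (resolventTrace M z).im := by
  have h1 : (1 / (m : ℂ)) = ((1 / m : ℝ) : ℂ) := by push_cast; rfl
  rw [resolventTrace_eq_sum hM hz, h1, Complex.im_ofReal_mul, Complex.im_sum]
  refine mul_nonneg (by positivity) (Finset.sum_nonneg fun i _ => ?_)
  rw [one_div, Complex.inv_im]
  simp only [Complex.sub_im, Complex.ofReal_im]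
  have := Complex.normSq_nonneg ((hM.eigenvalues i : ℂ) - z)
  have h2 : -(0 - z.im) = z.im := by ring
  rw [h2]
  positivity

theorem abs_limitBidiagonal_entries {A : ℝ} (hA : (m : ℝ) ≤ A) :
    (∀ i : Fin m, |Real.sqrt (A - (i : ℕ))| ≤ Real.sqrt A) ∧
      ∀ j : Fin (m - 1), |Real.sqrt ((m : ℝ) - 1 - (j : ℕ))| ≤ Real.sqrt A := by
  constructor <;> intro i <;> rw [abs_of_nonneg (Real.sqrt_nonneg _)] <;>
    apply Real.sqrt_le_sqrt
  · linarith [Nat.cast_nonneg (α := ℝ) (i : ℕ)]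
  · linarith [Nat.cast_nonneg (α := ℝ) (i : ℕ)]

/-- The approximate quadratic equation for the resolvent trace of the deterministic matrix. The
error is exactly the mean of `μ / (w - μ)²` over the eigenvalues `μ` of `B Bᵀ`, with `w = m z / d`,
and is bounded by means of the trace of `B Bᵀ`. -/
theorem limit_quadratic {d : ℝ} (hd : 0 < d) (hd1 : d ≤ 1) (hm : 1 ≤ m) {z : ℂ}
    (hz : 0 < z.im) :
    ‖d * z * resolventTrace (limitMatrix d m) z ^ 2 +
      (z + d - 1) * resolventTrace (limitMatrix d m) z + 1‖ ≤ 4 / (m * z.im ^ 2) := by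
  have hm0 : (0 : ℝ) < m := by exact_mod_cast hm
  have hmC : (m : ℂ) ≠ 0 := by exact_mod_cast hm0.ne'
  have hdC : (d : ℂ) ≠ 0 := by exact_mod_cast hd.ne'
  set A : ℝ := m / d with hAdef
  have hA : (m : ℝ) ≤ A := by
    rw [hAdef, le_div_iff₀ hd]
    nlinarith
  have hA0 : 0 < A := hm0.trans_le hA
  set B := limitBidiagonal A m with hB
  have hH : (B * Bᵀ).IsHermitian := isHermitian_gram B
  set μ := hH.eigenvalues with hμ
  set c : ℝ := d / m with hc
  have hc0 : 0 < c := by positivity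
  have hcC : (c : ℂ) ≠ 0 := by exact_mod_cast hc0.ne'
  set w : ℂ := z / c with hw
  have hwim : w.im = z.im / c := Complex.div_ofReal_im _ _
  have hw0 : 0 < w.im := by rw [hwim]; positivity
  have hp : (B * Bᵀ).charpoly = ∏ i, (Polynomial.X - Polynomial.C (μ i)) := by
    simpa using! hH.charpoly_eq
  have hric := riccati_of_ode hp (charpoly_limit_gram_ode hm hA rfl) hw0
  set T : ℂ := ∑ i, 1 / (w - μ i) with hT
  set T2 : ℂ := ∑ i, 1 / (w - μ i) ^ 2 with hT2
  have hs : resolventTrace (limitMatrix d m) z = -(1 / (d : ℂ)) * T := by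
    rw [limitMatrix_eq hd hd1, resolventTrace_smul hH hc0 hz, resolventTrace_eq_sum hH hw0, hT, hc]
    have : ∀ i, 1 / ((hH.eigenvalues i : ℂ) - w) = -(1 / (w - μ i)) := fun i => by
      rw [← neg_sub, one_div, inv_neg, one_div]
    rw [Finset.sum_congr rfl fun i _ => this i, Finset.sum_neg_distrib]
    push_cast
    field_simp
  have hz' : z = c * w := by rw [hw, mul_div_cancel₀ _ hcC]
  have hquad : d * z * resolventTrace (limitMatrix d m) z ^ 2 +
      (z + d - 1) * resolventTrace (limitMatrix d m) z + 1 =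
      1 / (m : ℂ) * ∑ i, (μ i : ℂ) / (w - μ i) ^ 2 := by
    have hsum : ∑ i, (μ i : ℂ) / (w - μ i) ^ 2 = w * T2 - T := by
      rw [hT2, hT, Finset.mul_sum, ← Finset.sum_sub_distrib]
      refine Finset.sum_congr rfl fun i _ => ?_
      have h3 : w - μ i ≠ 0 := fun h =>
        ofReal_sub_ne_zero hw0 (μ i) (by rw [← neg_sub, h, neg_zero])
      field_simp
      ring
    have hAC : (A : ℂ) = m / d := by rw [hAdef]; push_cast; rfl
    have hcC' : (c : ℂ) = d / m := by rw [hc]; push_cast; rfl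
    have hric' : w * T2 - T = w * T ^ 2 + (m / d - m - w) * T + m := by
      push_cast at hric
      rw [hAC] at hric
      linear_combination -hric
    rw [hsum, hric', hs, hz', hcC']
    field_simp
    ring
  have hμ0 : ∀ i, 0 ≤ μ i := by
    have hpsd : (B * Bᵀ).PosSemidef := by
      simpa using! posSemidef_self_mul_conjTranspose B
    exact fun i => hpsd.eigenvalues_nonneg i
  have htrace : ∑ i, μ i ≤ m * (4 * A) := by
    have h1 : (B * Bᵀ).trace = ∑ i, μ i := by simpa using! hH.trace_eq_sum_eigenvalues
    rw [← h1, Matrix.trace]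
    obtain ⟨hx, hy⟩ := abs_limitBidiagonal_entries hA
    have h2 : ∀ i, (B * Bᵀ).diag i ≤ 4 * A := fun i => by
      have h3 := sum_abs_mul_transpose_le (sum_abs_bidiagonal_row_le hx hy)
        (sum_abs_bidiagonal_col_le hx hy) (by positivity) i
      have h4 : 2 * Real.sqrt A * (2 * Real.sqrt A) = 4 * A := by
        rw [mul_mul_mul_comm, Real.mul_self_sqrt hA0.le]
        norm_num
      rw [h4] at h3
      exact ((le_abs_self _).trans (Finset.single_le_sum
        (f := fun j => |(B * Bᵀ) i j|) (fun j _ => abs_nonneg _) (Finset.mem_univ i))).trans h3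
    refine (Finset.sum_le_sum fun i _ => h2 i).trans (by simp)
  rw [hquad, norm_mul, norm_div, norm_one, Complex.norm_natCast]
  have hterm : ∀ i, ‖(μ i : ℂ) / (w - μ i) ^ 2‖ ≤ μ i / w.im ^ 2 := fun i => by
    rw [norm_div, norm_pow, Complex.norm_real, Real.norm_eq_abs, abs_of_nonneg (hμ0 i),
      norm_sub_rev]
    have := im_le_norm_ofReal_sub hw0 (μ i)
    have := hμ0 i
    gcongr
  calc 1 / (m : ℝ) * ‖∑ i, (μ i : ℂ) / (w - μ i) ^ 2‖ ≤ 1 / m * ∑ i, μ i / w.im ^ 2 := by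
        gcongr
        exact (norm_sum_le _ _).trans (Finset.sum_le_sum fun i _ => hterm i)
    _ = 1 / m * ((∑ i, μ i) / w.im ^ 2) := by rw [Finset.sum_div]
    _ ≤ 1 / m * (m * (4 * A) / w.im ^ 2) := by gcongr
    _ = d * (4 / (m * z.im ^ 2)) := by
        rw [hwim, hAdef, hc]
        field_simp
    _ ≤ 4 / (m * z.im ^ 2) := mul_le_of_le_one_left (by positivity) hd1

theorem norm_limit_sub_mpStieltjes_le {d κ : ℝ} (hd : 0 < d) (hd1 : d ≤ 1) (hκ : 0 < κ)
    (hm : 1 ≤ m) {z : ℂ} (hz : 0 < z.im) (hz1 : lambdaMinus d + κ < z.re)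
    (hz2 : z.re < lambdaPlus d - κ) :
    ‖resolventTrace (limitMatrix d m) z - mpStieltjes d z‖ ≤
      64 / κ ^ 3 * (1 / (m * z.im ^ 2)) := by
  have hherm : (limitMatrix d m).IsHermitian := by
    rw [limitMatrix_eq hd hd1]
    exact isHermitian_smul_gram _ _
  refine (norm_sub_mpStieltjes_le hd hd1 hκ hz hz1 hz2 (resolventTrace_im_nonneg hherm hz)
    rfl).trans ?_
  calc _ ≤ 16 / κ ^ 3 * (4 / (m * z.im ^ 2)) := by
        gcongr
        exact limit_quadratic hd hd1 hm hz
    _ = _ := by ring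

end Deterministic

end BetaLaguerre

namespace BetaLaguerre

/-! ### Concentration of the chi distribution -/

section Chi

open Set

/-- The exponential moment `E exp(t (χ_r² - r))` is at most `exp (4 t² r)` for `t ≤ 1/4`, stated
as the Chernoff bound it implies. -/
theorem chiMeasure_chernoff {r t v : ℝ} (hr : 0 < r) (ht : t ≤ 1 / 4) {S : Set ℝ}
    (hS : MeasurableSet S) (hSt : ∀ x ∈ S, 0 < x → v ≤ t * (x ^ 2 - r)) :
    chiMeasure r S ≤ ENNReal.ofReal (Real.exp (4 * t ^ 2 * r - v)) := by
  set b : ℝ := 1 / 2 - t with hb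
  have hb0 : 0 < b := by linarith
  set K : ℝ := (2 : ℝ) ^ (1 - r / 2) / Real.Gamma (r / 2) * Real.exp (-t * r - v) with hK
  have hG : 0 < Real.Gamma (r / 2) := Real.Gamma_pos_of_pos (by positivity)
  have hK0 : 0 ≤ K := by positivity
  have hint : IntegrableOn (fun x : ℝ => K * (x ^ (r - 1) * Real.exp (-b * x ^ (2 : ℝ)))) (Ioi 0) :=
    (integrableOn_rpow_mul_exp_neg_mul_rpow (by linarith) (by norm_num) hb0).const_mul K
  have hle : chiMeasure r S ≤
      ∫⁻ x in Ioi (0 : ℝ), ENNReal.ofReal (K * (x ^ (r - 1) * Real.exp (-b * x ^ (2 : ℝ)))) := by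
    rw [chiMeasure, withDensity_apply _ hS, ← lintegral_indicator hS,
      ← lintegral_indicator measurableSet_Ioi]
    refine lintegral_mono fun x => ?_
    by_cases hx : 0 < x
    · rw [indicator_of_mem (show x ∈ Ioi (0 : ℝ) from hx)]
      by_cases hxS : x ∈ S
      · rw [indicator_of_mem hxS]
        apply ENNReal.ofReal_le_ofReal
        rw [chiPDFReal, if_pos hx, hK, Real.rpow_two]
        have h1 := hSt x hxS hx
        have h2 : Real.exp (-x ^ 2 / 2) ≤ Real.exp (-t * r - v) * Real.exp (-b * x ^ 2) := by
          rw [← Real.exp_add, Real.exp_le_exp, hb]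
          nlinarith
        calc (2 : ℝ) ^ (1 - r / 2) / Real.Gamma (r / 2) * x ^ (r - 1) * Real.exp (-x ^ 2 / 2)
            ≤ (2 : ℝ) ^ (1 - r / 2) / Real.Gamma (r / 2) * x ^ (r - 1) *
              (Real.exp (-t * r - v) * Real.exp (-b * x ^ 2)) := by gcongr
          _ = _ := by ring
      · rw [indicator_of_notMem hxS]
        exact zero_le
    · rw [indicator_of_notMem (show x ∉ Ioi (0 : ℝ) from hx)]
      by_cases hxS : x ∈ S
      · rw [indicator_of_mem hxS, chiPDFReal, if_neg hx, ENNReal.ofReal_zero]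
      · rw [indicator_of_notMem hxS]
  refine hle.trans ?_
  rw [← ofReal_integral_eq_lintegral_ofReal hint]
  swap
  · refine (ae_restrict_iff' measurableSet_Ioi).mpr (ae_of_all _ fun x hx => ?_)
    have : (0 : ℝ) < x := hx
    simp only [Pi.zero_apply]
    positivity
  apply ENNReal.ofReal_le_ofReal
  rw [integral_const_mul, integral_rpow_mul_exp_neg_mul_rpow (by norm_num) (by linarith) hb0,
    sub_add_cancel, hK]
  have h2b : 2 * b = 1 - 2 * t := by rw [hb]; ring
  have hval : (2 : ℝ) ^ (1 - r / 2) / Real.Gamma (r / 2) * Real.exp (-t * r - v) *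
      (b ^ (-r / 2) * (1 / 2) * Real.Gamma (r / 2)) =
      (1 - 2 * t) ^ (-(r / 2)) * Real.exp (-t * r - v) := by
    rw [← h2b, Real.mul_rpow (by norm_num) hb0.le, sub_eq_add_neg, Real.rpow_add (by norm_num),
      Real.rpow_one, neg_div]
    field_simp
  rw [hval, Real.rpow_def_of_pos (by linarith), ← Real.exp_add, Real.exp_le_exp]
  have hlog := Real.one_sub_inv_le_log_of_pos (show 0 < 1 - 2 * t by linarith)
  have hfrac : (1 - 2 * t)⁻¹ ≤ 1 + 2 * t + 8 * t ^ 2 := by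
    rw [inv_le_iff_one_le_mul₀ (by linarith)]
    nlinarith [mul_nonneg (sq_nonneg t) (show 0 ≤ 1 - 4 * t by linarith)]
  have : -Real.log (1 - 2 * t) * (r / 2) ≤ (2 * t + 8 * t ^ 2) * (r / 2) := by
    gcongr
    linarith
  linarith

/-- The rate at which chi variables with at least `β` degrees of freedom concentrate. -/
noncomputable def chiRate (β : ℝ) : ℝ := min 1 (Real.sqrt β) / 4

theorem chiRate_pos {β : ℝ} (hβ : 0 < β) : 0 < chiRate β := by
  have : 0 < min 1 (Real.sqrt β) := lt_min one_pos (Real.sqrt_pos.mpr hβ)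
  rw [chiRate]
  positivity

/-- A chi variable with `r ≥ β` degrees of freedom has exponential tails around `√r` whose rate
depends only on `β`. -/
theorem chiMeasure_tail {β r u : ℝ} (hβ : 0 < β) (hr : β ≤ r) (hu : 0 ≤ u) :
    chiMeasure r {x | u < |x - Real.sqrt r|} ≤
      ENNReal.ofReal (2 * Real.exp (4 * chiRate β ^ 2 - chiRate β * u)) := by
  have hr0 : 0 < r := hβ.trans_le hr
  have hsr : 0 < Real.sqrt r := Real.sqrt_pos.mpr hr0
  have hsq : Real.sqrt r ^ 2 = r := Real.sq_sqrt hr0.le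
  set c := chiRate β with hc
  have hc0 : 0 < c := chiRate_pos hβ
  -- With this `t` the exponent `4 t² r` stays bounded while `t (χ² - r) ≥ c u` on both tails.
  set t := c / Real.sqrt r with ht
  have ht0 : 0 < t := by positivity
  have htr : t * Real.sqrt r = c := by rw [ht]; field_simp
  have ht4 : t ≤ 1 / 4 := by
    rw [ht, div_le_iff₀ hsr, hc, chiRate]
    have := min_le_right 1 (Real.sqrt β)
    have := Real.sqrt_le_sqrt hr
    linarith
  have ht2 : 4 * t ^ 2 * r = 4 * c ^ 2 := by
    rw [← htr, mul_pow, hsq]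
    ring
  have hsub : {x | u < |x - Real.sqrt r|} ⊆
      {x | Real.sqrt r + u < x} ∪ {x | x < Real.sqrt r - u} := by
    intro x hx
    rcases lt_abs.mp (show u < |x - Real.sqrt r| from hx) with h | h
    · left
      change Real.sqrt r + u < x
      linarith
    · right
      change x < Real.sqrt r - u
      linarith
  have h1 : chiMeasure r {x | Real.sqrt r + u < x} ≤
      ENNReal.ofReal (Real.exp (4 * c ^ 2 - c * u)) := by
    rw [← ht2]
    refine chiMeasure_chernoff hr0 ht4 measurableSet_Ioi fun x hx _ => ?_
    have hx' : Real.sqrt r + u < x := hx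
    have : u * Real.sqrt r ≤ x ^ 2 - r := by nlinarith
    calc c * u = t * (u * Real.sqrt r) := by rw [← htr]; ring
      _ ≤ _ := by gcongr
  have h2 : chiMeasure r {x | x < Real.sqrt r - u} ≤
      ENNReal.ofReal (Real.exp (4 * c ^ 2 - c * u)) := by
    rw [← ht2, ← neg_sq t]
    refine chiMeasure_chernoff hr0 (by linarith) measurableSet_Iio fun x hx hx0 => ?_
    have hx' : x < Real.sqrt r - u := hx
    have : u * Real.sqrt r ≤ r - x ^ 2 := by nlinarith
    calc c * u = t * (u * Real.sqrt r) := by rw [← htr]; ring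
      _ ≤ t * (r - x ^ 2) := by gcongr
      _ = _ := by ring
  calc chiMeasure r {x | u < |x - Real.sqrt r|} ≤ _ := measure_mono hsub
    _ ≤ _ := measure_union_le _ _
    _ ≤ ENNReal.ofReal (Real.exp (4 * c ^ 2 - c * u)) +
        ENNReal.ofReal (Real.exp (4 * c ^ 2 - c * u)) := add_le_add h1 h2
    _ = _ := by rw [← ENNReal.ofReal_add (by positivity) (by positivity), two_mul]

theorem chi_family_tail {Ω : ℕ → Type*} [∀ m, MeasurableSpace (Ω m)] {P : ∀ m, Measure (Ω m)}
    {β d : ℝ} {X : ∀ m, Fin m → Ω m → ℝ} {Y : ∀ m, Fin (m - 1) → Ω m → ℝ}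
    (h : IsChiFamily P β d X Y) (hβ : 0 < β) (hd : 0 < d) (hd1 : d ≤ 1) (m : ℕ) {u : ℝ}
    (hu : 0 ≤ u) :
    P m {ω | (∀ i, |X m i ω - Real.sqrt (2 * param β d m - β * (i : ℕ))| ≤ u) ∧
        ∀ j, |Y m j ω - Real.sqrt (β * ((m : ℝ) - 1 - (j : ℕ)))| ≤ u}ᶜ ≤
      ENNReal.ofReal (4 * m * Real.exp (4 * chiRate β ^ 2 - chiRate β * u)) := by
  set q : ℝ := 2 * Real.exp (4 * chiRate β ^ 2 - chiRate β * u) with hq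
  have hq0 : 0 ≤ q := by positivity
  have hmeas : ∀ a : ℝ, MeasurableSet {x : ℝ | u < |x - a|} := fun a =>
    measurableSet_lt measurable_const (by fun_prop)
  have hX : ∀ i, P m {ω | u < |X m i ω - Real.sqrt (2 * param β d m - β * (i : ℕ))|} ≤
      ENNReal.ofReal q := fun i => by
    rw [(h.diag m i).measure_eq (p := fun x => u < |x - _|) (hmeas _)]
    refine chiMeasure_tail hβ ?_ hu
    have h1 : 2 * param β d m = β * (m / d) := by
      rw [param]
      field_simp
    have h2 : (m : ℝ) ≤ m / d := by
      rw [le_div_iff₀ hd]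
      exact mul_le_of_le_one_right (Nat.cast_nonneg _) hd1
    have h3 : ((i : ℕ) : ℝ) + 1 ≤ m := by exact_mod_cast i.isLt
    rw [h1]
    nlinarith
  have hY : ∀ j, P m {ω | u < |Y m j ω - Real.sqrt (β * ((m : ℝ) - 1 - (j : ℕ)))|} ≤
      ENNReal.ofReal q := fun j => by
    rw [(h.subdiag m j).measure_eq (p := fun x => u < |x - _|) (hmeas _)]
    refine chiMeasure_tail hβ ?_ hu
    have h3 : ((j : ℕ) : ℝ) + 1 + 1 ≤ m := by
      have := j.isLt
      exact_mod_cast (by omega : (j : ℕ) + 1 + 1 ≤ m)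
    nlinarith
  have hsub : {ω | (∀ i, |X m i ω - Real.sqrt (2 * param β d m - β * (i : ℕ))| ≤ u) ∧
        ∀ j, |Y m j ω - Real.sqrt (β * ((m : ℝ) - 1 - (j : ℕ)))| ≤ u}ᶜ ⊆
      (⋃ i, {ω | u < |X m i ω - Real.sqrt (2 * param β d m - β * (i : ℕ))|}) ∪
        ⋃ j, {ω | u < |Y m j ω - Real.sqrt (β * ((m : ℝ) - 1 - (j : ℕ)))|} := by
    intro ω hω
    by_contra hcon
    simp only [mem_union, mem_iUnion, Set.mem_ofPred_eq, not_or, not_exists, not_lt] at hcon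
    exact hω hcon
  have hun : ∀ {n : ℕ} (E : Fin n → Set (Ω m)), n ≤ m → (∀ i, P m (E i) ≤ ENNReal.ofReal q) →
      P m (⋃ i, E i) ≤ ENNReal.ofReal (m * q) := by
    intro n E hn hE
    calc P m (⋃ i, E i) ≤ ∑ i, P m (E i) := measure_iUnion_fintype_le _ _
      _ ≤ ∑ _i : Fin n, ENNReal.ofReal q := Finset.sum_le_sum fun i _ => hE i
      _ = ENNReal.ofReal (n * q) := by
          rw [Finset.sum_const, Finset.card_univ, Fintype.card_fin, nsmul_eq_mul,
            ENNReal.ofReal_mul (Nat.cast_nonneg n), ENNReal.ofReal_natCast]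
      _ ≤ _ := by
          apply ENNReal.ofReal_le_ofReal
          gcongr
  calc _ ≤ _ := measure_mono hsub
    _ ≤ _ := measure_union_le _ _
    _ ≤ ENNReal.ofReal (m * q) + ENNReal.ofReal (m * q) :=
        add_le_add (hun _ le_rfl hX) (hun _ (by omega) hY)
    _ = _ := by
        rw [← ENNReal.ofReal_add (by positivity) (by positivity), hq]
        congr 1
        ring

end Chi

/-! ### Stability of the random matrix and the local law -/

section LocalLaw

open Matrix

/-- Comparison of the two resolvent traces when every entry of the bidiagonal matrix is within `u`
of its typical value. -/
theorem norm_laguerre_sub_limit_le {β d : ℝ} (hβ : 0 < β) (hd : 0 < d) (hd1 : d ≤ 1) {m : ℕ}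
    (hm : 1 ≤ m) {x : Fin m → ℝ} {y : Fin (m - 1) → ℝ} {u : ℝ} (hu : 0 ≤ u)
    (hx : ∀ i, |x i - Real.sqrt (2 * param β d m - β * (i : ℕ))| ≤ u)
    (hy : ∀ j, |y j - Real.sqrt (β * ((m : ℝ) - 1 - (j : ℕ)))| ≤ u) {z : ℂ} (hz : 0 < z.im) :
    ‖resolventTrace (laguerreMatrix β d x y) z - resolventTrace (limitMatrix d m) z‖ ≤
      d / (β * m) * (4 * u * (2 * (Real.sqrt β * Real.sqrt (m / d)) + u)) / z.im ^ 2 := by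
  have hm0 : (0 : ℝ) < m := by exact_mod_cast hm
  set c : ℝ := d / (β * m) with hc
  have hc0 : 0 < c := by positivity
  set A : ℝ := m / d with hAdef
  have hA : (m : ℝ) ≤ A := by
    rw [hAdef, le_div_iff₀ hd]
    nlinarith
  set x' : Fin m → ℝ := fun i => Real.sqrt β * Real.sqrt (A - (i : ℕ)) with hx'
  set y' : Fin (m - 1) → ℝ := fun j => Real.sqrt β * Real.sqrt ((m : ℝ) - 1 - (j : ℕ)) with hy'
  have hxx : ∀ i, |x i - x' i| ≤ u := fun i => by
    have h1 : 2 * param β d m - β * (i : ℕ) = β * (A - (i : ℕ)) := by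
      rw [param, hAdef]
      field_simp
    have h2 := hx i
    rwa [h1, Real.sqrt_mul hβ.le] at h2
  have hyy : ∀ j, |y j - y' j| ≤ u := fun j => by
    have h2 := hy j
    rwa [Real.sqrt_mul hβ.le] at h2
  set R : ℝ := Real.sqrt β * Real.sqrt A with hR
  obtain ⟨hbx, hby⟩ := abs_limitBidiagonal_entries hA
  have hx'R : ∀ i, |x' i| ≤ R := fun i => by
    rw [hx', abs_mul, abs_of_nonneg (Real.sqrt_nonneg β)]
    exact mul_le_mul_of_nonneg_left (hbx i) (Real.sqrt_nonneg β)
  have hy'R : ∀ i, |y' i| ≤ R := fun i => by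
    rw [hy', abs_mul, abs_of_nonneg (Real.sqrt_nonneg β)]
    exact mul_le_mul_of_nonneg_left (hby i) (Real.sqrt_nonneg β)
  have hlim : limitMatrix d m = c • (bidiagonal x' y' * (bidiagonal x' y')ᵀ) := by
    have h1 : bidiagonal x' y' = Real.sqrt β • limitBidiagonal A m := by
      rw [limitBidiagonal, bidiagonal_smul]
    rw [limitMatrix_eq hd hd1, h1, transpose_smul, Matrix.smul_mul, Matrix.mul_smul, smul_smul,
      smul_smul, mul_assoc, Real.mul_self_sqrt hβ.le, hc]
    congr 1
    field_simp
  have hrow : ∀ i, ∑ j, |(laguerreMatrix β d x y - limitMatrix d m) i j| ≤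
      c * (4 * u * (2 * R + u)) := fun i => by
    have h1 := sum_abs_gram_sub_le (by positivity) hu hx'R hy'R hxx hyy i
    rw [hlim, laguerreMatrix, ← smul_sub]
    simp only [Matrix.smul_apply, smul_eq_mul, abs_mul]
    rw [← hc, abs_of_pos hc0, ← Finset.mul_sum]
    gcongr
  have hM : (laguerreMatrix β d x y).IsHermitian := isHermitian_smul_gram _ _
  have hN : (limitMatrix d m).IsHermitian := by
    rw [hlim]
    exact isHermitian_smul_gram _ _
  rw [norm_sub_rev]
  refine norm_resolventTrace_sub_le hm hN hM hz hrow fun j => ?_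
  refine le_trans (le_of_eq (Finset.sum_congr rfl fun i _ => ?_)) (hrow j)
  have h2 := (hM.sub hN).apply i j
  rw [star_trivial] at h2
  rw [h2]

/-- A stretched exponential beats every power. -/
theorem exists_pow_mul_exp_le {c δ : ℝ} (hc : 0 < c) (hδ : 0 < δ) (k : ℕ) :
    ∃ C : ℝ, ∀ m : ℕ, 1 ≤ m → (m : ℝ) ^ k * Real.exp (-(c * (m : ℝ) ^ δ)) ≤ C := by
  obtain ⟨N, hN⟩ := exists_nat_ge (k / δ)
  refine ⟨N.factorial / c ^ N, fun m hm => ?_⟩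
  have hm1 : (1 : ℝ) ≤ m := by exact_mod_cast hm
  have hm0 : (0 : ℝ) < m := by linarith
  have h1 := Real.pow_div_factorial_le_exp (c * (m : ℝ) ^ δ) (by positivity) N
  have h2 : (m : ℝ) ^ k ≤ ((m : ℝ) ^ δ) ^ N := by
    rw [← Real.rpow_natCast, ← Real.rpow_natCast, ← Real.rpow_mul hm0.le]
    apply Real.rpow_le_rpow_of_exponent_le hm1
    rw [div_le_iff₀ hδ] at hN
    linarith
  rw [Real.exp_neg, ← div_eq_mul_inv, div_le_div_iff₀ (Real.exp_pos _) (by positivity)]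
  rw [div_le_iff₀ (by positivity), mul_pow] at h1
  calc (m : ℝ) ^ k * c ^ N ≤ ((m : ℝ) ^ δ) ^ N * c ^ N := by gcongr
    _ = c ^ N * ((m : ℝ) ^ δ) ^ N := by ring
    _ ≤ _ := by linarith

/-- With `u = m^{ε/2}`, a point of the domain satisfies `(Im z)² ≥ u⁴ / √m`. -/
theorem im_sq_ge_of_mem_bulkDomain {d ε κ : ℝ} {m : ℕ} (hm : 1 ≤ m) {z : ℂ}
    (hz : z ∈ bulkDomain d ε κ m) :
    0 < z.im ∧ ((m : ℝ) ^ (ε / 2)) ^ 4 / Real.sqrt m ≤ z.im ^ 2 := by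
  have hm0 : (0 : ℝ) < m := by exact_mod_cast hm
  have h1 : (m : ℝ) ^ (-(1 / 4 : ℝ) + ε) < z.im := hz.1
  have h0 : 0 < (m : ℝ) ^ (-(1 / 4 : ℝ) + ε) := by positivity
  refine ⟨h0.trans h1, ?_⟩
  have h2 : ((m : ℝ) ^ (ε / 2)) ^ 4 / Real.sqrt m = ((m : ℝ) ^ (-(1 / 4 : ℝ) + ε)) ^ 2 := by
    rw [Real.sqrt_eq_rpow, ← Real.rpow_natCast, ← Real.rpow_natCast, ← Real.rpow_mul hm0.le,
      ← Real.rpow_mul hm0.le, ← Real.rpow_sub hm0]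
    congr 1
    push_cast
    ring
  rw [h2]
  gcongr

theorem deterministic_local_law {d ε κ : ℝ} (hε : 0 < ε) (hκ : 0 < κ) (hd : 0 < d) (hd1 : d ≤ 1)
    {m : ℕ} (hm : 1 ≤ m) {z : ℂ} (hz : z ∈ bulkDomain d ε κ m) :
    ‖resolventTrace (limitMatrix d m) z - mpStieltjes d z‖ ≤ 64 / κ ^ 3 * (m : ℝ) ^ (-ε) := by
  obtain ⟨him, hsq⟩ := im_sq_ge_of_mem_bulkDomain hm hz
  have hm1 : (1 : ℝ) ≤ m := by exact_mod_cast hm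
  have hm0 : (0 : ℝ) < m := by linarith
  refine (norm_limit_sub_mpStieltjes_le hd hd1 hκ hm him hz.2.1 hz.2.2).trans ?_
  set u := (m : ℝ) ^ (ε / 2) with hu
  have hu1 : 1 ≤ u := Real.one_le_rpow hm1 (by positivity)
  have hue : (m : ℝ) ^ (-ε) = 1 / u ^ 2 := by
    rw [hu, ← Real.rpow_natCast, ← Real.rpow_mul hm0.le, Real.rpow_neg hm0.le, one_div]
    congr 2
    push_cast
    ring
  rw [hue]
  have hs1 : 1 ≤ Real.sqrt m := Real.one_le_sqrt.mpr hm1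
  have hss : Real.sqrt m * Real.sqrt m = m := Real.mul_self_sqrt hm0.le
  have h1 : u ^ 2 ≤ m * z.im ^ 2 := by
    calc u ^ 2 ≤ u ^ 4 := pow_le_pow_right₀ hu1 (by norm_num)
      _ ≤ Real.sqrt m * u ^ 4 := le_mul_of_one_le_left (by positivity) hs1
      _ = m * (u ^ 4 / Real.sqrt m) := by
          nth_rewrite 2 [← hss]
          field_simp
      _ ≤ m * z.im ^ 2 := by gcongr
  gcongr

/-- On the event that all entries are within `m^{ε/2}` of their typical values, the local law
holds as soon as `m` exceeds a threshold depending on `β` and `d`. -/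
theorem laguerre_local_law_of_entries {β d ε κ : ℝ} (hε : 0 < ε) (hβ : 0 < β) (hd : 0 < d)
    (hd1 : d ≤ 1) {m : ℕ} (hm : 1 ≤ m) {x : Fin m → ℝ} {y : Fin (m - 1) → ℝ}
    (hx : ∀ i, |x i - Real.sqrt (2 * param β d m - β * (i : ℕ))| ≤ (m : ℝ) ^ (ε / 2))
    (hy : ∀ j, |y j - Real.sqrt (β * ((m : ℝ) - 1 - (j : ℕ)))| ≤ (m : ℝ) ^ (ε / 2))
    (hK : d / β * (8 * (Real.sqrt β / Real.sqrt d) + 4) ≤ (m : ℝ) ^ (ε / 2)) {z : ℂ}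
    (hz : z ∈ bulkDomain d ε κ m) :
    ‖resolventTrace (laguerreMatrix β d x y) z - resolventTrace (limitMatrix d m) z‖ ≤
      (m : ℝ) ^ (-(ε / 8)) := by
  obtain ⟨him, hsq⟩ := im_sq_ge_of_mem_bulkDomain hm hz
  have hm1 : (1 : ℝ) ≤ m := by exact_mod_cast hm
  have hm0 : (0 : ℝ) < m := by linarith
  have hmain := norm_laguerre_sub_limit_le hβ hd hd1 hm (by positivity) hx hy him
  refine hmain.trans ?_
  have hle : ((m : ℝ) ^ (ε / 2))⁻¹ ≤ (m : ℝ) ^ (-(ε / 8)) := by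
    rw [← Real.rpow_neg hm0.le]
    exact Real.rpow_le_rpow_of_exponent_le hm1 (by linarith)
  refine le_trans ?_ hle
  set u := (m : ℝ) ^ (ε / 2) with hu
  have hu1 : 1 ≤ u := Real.one_le_rpow hm1 (by positivity)
  set S := Real.sqrt m with hS
  have hs1 : 1 ≤ S := Real.one_le_sqrt.mpr hm1
  have hss : (m : ℝ) = S ^ 2 := (Real.sq_sqrt hm0.le).symm
  have hS0 : 0 < S := by linarith
  have hsd : 0 < Real.sqrt d := Real.sqrt_pos.mpr hd
  rw [Real.sqrt_div hm0.le]
  set ρ := Real.sqrt β / Real.sqrt d with hρ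
  have hρ0 : 0 ≤ ρ := by positivity
  have hρS : Real.sqrt β * (Real.sqrt m / Real.sqrt d) = ρ * S := by rw [hρ]; ring
  rw [hρS]
  calc d / (β * m) * (4 * u * (2 * (ρ * S) + u)) / z.im ^ 2
      ≤ d / (β * m) * (4 * u * (2 * (ρ * S) + u)) / (u ^ 4 / S) := by gcongr
    _ = d / β * (8 * ρ * u + 4 * u ^ 2 / S) / u ^ 4 := by
        rw [hss]
        field_simp
        ring
    _ ≤ d / β * (8 * ρ * u ^ 2 + 4 * u ^ 2) / u ^ 4 := by
        have h1 : u ≤ u ^ 2 := by nlinarith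
        have h2 : 4 * u ^ 2 / S ≤ 4 * u ^ 2 := div_le_self (by positivity) hs1
        gcongr
    _ = d / β * (8 * ρ + 4) / u ^ 2 := by field_simp
    _ ≤ u / u ^ 2 := by gcongr
    _ = u⁻¹ := by field_simp

end LocalLaw

end BetaLaguerre

theorem mainTheorem3 (ε κ : ℝ) (hε : 0 < ε) (hκ : 0 < κ) :
    ∃ C : ℝ, 0 < C ∧ ∀ (β d : ℝ), 0 < β → 0 < d → d ≤ 1 →
      (∀ m : ℕ, 1 ≤ m → ∀ z ∈ bulkDomain d ε κ m,
        ‖resolventTrace (limitMatrix d m) z - mpStieltjes d z‖ ≤ C * (m : ℝ) ^ (-ε)) ∧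
      ∀ (Ω : ℕ → Type*) [∀ m, MeasurableSpace (Ω m)] (P : ∀ m, Measure (Ω m))
        [∀ m, IsProbabilityMeasure (P m)]
        (X : ∀ m, Fin m → Ω m → ℝ) (Y : ∀ m, Fin (m - 1) → Ω m → ℝ),
        IsChiFamily P β d X Y →
        WithOverwhelmingProbability P (fun m => {ω | ∀ z ∈ bulkDomain d ε κ m,
          ‖resolventTrace (laguerreMatrix β d (fun i => X m i ω) (fun j => Y m j ω)) z
              - resolventTrace (limitMatrix d m) z‖ ≤ C * (m : ℝ) ^ (-(ε / 8)) ∧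
          ‖resolventTrace (laguerreMatrix β d (fun i => X m i ω) (fun j => Y m j ω)) z
              - mpStieltjes d z‖ ≤ C * (m : ℝ) ^ (-(ε / 8))}) := by
  set C₁ : ℝ := 64 / κ ^ 3 with hC₁
  have hC₁0 : 0 < C₁ := by positivity
  refine ⟨1 + C₁, by positivity, fun β d hβ hd hd1 => ⟨fun m hm z hz => ?_, ?_⟩⟩
  · refine (deterministic_local_law hε hκ hd hd1 hm hz).trans ?_
    gcongr
    linarith
  intro Ω _ P _ X Y hfam k
  set c := chiRate β with hc
  have hc0 : 0 < c := chiRate_pos hβ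
  set K : ℝ := d / β * (8 * (Real.sqrt β / Real.sqrt d) + 4) with hK
  have hK0 : 0 < K := by positivity
  obtain ⟨C₂, hC₂⟩ := exists_pow_mul_exp_le hc0 (half_pos hε) (k + 1)
  have hC₂0 : 0 ≤ C₂ := le_trans (by positivity) (hC₂ 1 le_rfl)
  -- The first summand serves the finitely many `m` with `m^{ε/2} < K`.
  refine ⟨(K ^ (2 / ε)) ^ k + 4 * Real.exp (4 * c ^ 2) * C₂, fun m hm => ?_⟩
  have hm1 : (1 : ℝ) ≤ m := by exact_mod_cast hm
  have hm0 : (0 : ℝ) < m := by linarith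
  rw [Real.rpow_neg hm0.le, Real.rpow_natCast, ← div_eq_mul_inv]
  rcases lt_or_ge ((m : ℝ) ^ (ε / 2)) K with hlt | hge
  · refine prob_le_one.trans ?_
    rw [← ENNReal.ofReal_one]
    apply ENNReal.ofReal_le_ofReal
    rw [le_div_iff₀ (by positivity), one_mul]
    have h1 : (m : ℝ) ≤ K ^ (2 / ε) := by
      have h2 : (m : ℝ) = ((m : ℝ) ^ (ε / 2)) ^ (2 / ε) := by
        rw [← Real.rpow_mul hm0.le]
        have : ε / 2 * (2 / ε) = 1 := by field_simp
        rw [this, Real.rpow_one]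
      rw [h2]
      exact Real.rpow_le_rpow (by positivity) hlt.le (by positivity)
    have h3 : (m : ℝ) ^ k ≤ (K ^ (2 / ε)) ^ k := by gcongr
    have h4 : 0 ≤ 4 * Real.exp (4 * c ^ 2) * C₂ := by positivity
    linarith
  · refine (measure_mono (Set.compl_subset_compl.mpr ?_)).trans
      ((chi_family_tail hfam hβ hd hd1 m (u := (m : ℝ) ^ (ε / 2)) (by positivity)).trans ?_)
    · rintro ω ⟨hx, hy⟩ z hz
      have h1 := laguerre_local_law_of_entries hε hβ hd hd1 hm hx hy hge hz
      have h2 := deterministic_local_law hε hκ hd hd1 hm hz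
      have h3 : (m : ℝ) ^ (-ε) ≤ (m : ℝ) ^ (-(ε / 8)) :=
        Real.rpow_le_rpow_of_exponent_le hm1 (by linarith)
      have h4 : 0 < (m : ℝ) ^ (-(ε / 8)) := by positivity
      have h5 : C₁ * (m : ℝ) ^ (-ε) ≤ C₁ * (m : ℝ) ^ (-(ε / 8)) := by gcongr
      refine ⟨h1.trans ?_, ?_⟩
      · nlinarith
      · refine (norm_sub_le_norm_sub_add_norm_sub _
          (resolventTrace (limitMatrix d m) z) _).trans ?_
        linarith
    · apply ENNReal.ofReal_le_ofReal
      rw [le_div_iff₀ (by positivity), sub_eq_add_neg, Real.exp_add]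
      have h1 := hC₂ m hm
      calc 4 * (m : ℝ) * (Real.exp (4 * c ^ 2) * Real.exp (-(c * (m : ℝ) ^ (ε / 2)))) * (m : ℝ) ^ k
          = 4 * Real.exp (4 * c ^ 2) *
            ((m : ℝ) ^ (k + 1) * Real.exp (-(c * (m : ℝ) ^ (ε / 2)))) := by ring
        _ ≤ 4 * Real.exp (4 * c ^ 2) * C₂ := by gcongr
        _ ≤ _ := by
          have : 0 ≤ (K ^ (2 / ε)) ^ k := by positivity
          linarith
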